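/- For an integer $j\ge 1$ and a positive integer $n$ let $b_j(n)=1$ if $n=X^2+jY^2$ for some integers $X,Y$, and $b_j(n)=0$ otherwise. For real $x$ put $B_j(x)=\sum_{1\le n\le x}b_j(n)$, the number of positive integers $n\le x$ represented by the quadratic form $X^2+jY^2$. Then for every real $x\ge 10^{9111}$ we have $B_1(x)\ge B_3(x)$. -/

import Mathlib

open Classical in
/-- The characteristic function `b_j` of the integers represented by the quadratic form
`X ^ 2 + j * Y ^ 2` with integers `X` and `Y`: it is `1` at represented `n` and `0` otherwise. -/
noncomputable def b (j n : ℕ) : ℕ :=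
  if ∃ X Y : ℤ, (n : ℤ) = X ^ 2 + (j : ℤ) * Y ^ 2 then 1 else 0

/-- The summatory function `B_j(x) = ∑_{1 ≤ n ≤ x} b_j(n)` of a real variable `x`: the sum runs over
the positive integers `n ≤ x` (and is empty for `x < 1`). -/
noncomputable def B (j : ℕ) (x : ℝ) : ℕ :=
  ∑ n ∈ Finset.Icc 1 ⌊x⌋₊, b j n

open Finset ArithmeticFunction MeasureTheory
open scoped ArithmeticFunction.Moebius ArithmeticFunction.zeta

/-! Let χ be the character mod 4 or mod 3, f = `normInd χ`, g = `splitInd χ`, B(x) = ∑_{n≤x} f(n)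
and M(x) = ∑_{n≤x} f(n)/n. The mod 4 function f counts the values of X²+Y² exactly, and the mod 3
one bounds those of X²+3Y² from above (`cast_B_one`, `cast_B_three_le`). Both counts have order
x/√(log x), so everything rests on comparing constants effectively. Evaluating those constants is
avoided: a failure at one large x is propagated to infinity and refuted there.

Locally, everything comes from r = g * f = 1 * χ, whose sums the hyperbola method controls: R(y) =
L(1,χ) y + O(√y). Since g is completely multiplicative, μg inverts it. Convolving μg with r log, r/n
and r turns the estimates for r into 2 B(x) log x = x M(x) + error, where the error is a sum of f(n)
w(x/n) with w(y) of size √y log y (`abs_two_log_mul_psum_sub_le`). Using f ≤ 1 gives a first bound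
for B. Feeding that bound back into the error gives relative precision 345/log x
(`abs_two_log_mul_psum_sub_le_div_log`).

The mean P(u) = M(u) - B(u)/u = ∫₁ᵘ B(t)/t² dt then satisfies u P'/P = 1/(2 log u) + O(1/log² u), so
P(u)/√(log u) is constant up to a factor close to 1. Hence B₁(x) ≤ B₃(x) at a single x forces M₁(u)
≤ 1.06 M₃(u) for all u ≥ x (`psum_recip_le_of_psum_le`).

At infinity, convolution squares decide. Because f = g * (nonsplit part), f * f is r convolved with
an explicit sparse function, and its logarithmic sum is at least, or at most, an explicit multiple
of L(1,χ) log y (`exists_le_psum_mul_self`, `exists_psum_mul_self_le`). Domination of M₁ by 1.06 M₃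
passes to the squares at the cost of 1.06² and O(√(log y)), which the values of the constants
contradict (`psum_normInd_lt`). -/

/-! ### Summatory functions and Dirichlet convolution -/

/-- The summatory function of an arithmetic function. -/
noncomputable def psum (a : ArithmeticFunction ℝ) (x : ℝ) : ℝ := ∑ n ∈ Ioc 0 ⌊x⌋₊, a n

/-- The arithmetic function `n ↦ 1 / n`. -/
noncomputable def recip : ArithmeticFunction ℝ := ⟨fun n => (n : ℝ)⁻¹, by simp⟩

@[simp] lemma recip_apply (n : ℕ) : recip n = (n : ℝ)⁻¹ := rfl

lemma psum_mul (a b : ArithmeticFunction ℝ) (x : ℝ) :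
    psum (a * b) x = ∑ n ∈ Ioc 0 ⌊x⌋₊, a n * psum b (x / n) := by
  unfold psum
  rw [sum_Ioc_mul_eq_sum_sum]
  refine sum_congr rfl fun n _ => ?_
  rw [Nat.floor_div_natCast]

lemma psum_mono {a b : ArithmeticFunction ℝ} (h : ∀ n, a n ≤ b n) (x : ℝ) : psum a x ≤ psum b x :=
  sum_le_sum fun n _ => h n

lemma psum_mono_right {a : ArithmeticFunction ℝ} (h : ∀ n, 0 ≤ a n) {x y : ℝ} (hxy : x ≤ y) :
    psum a x ≤ psum a y := by
  unfold psum
  exact sum_le_sum_of_subset_of_nonneg (Ioc_subset_Ioc_right (Nat.floor_mono hxy)) fun n _ _ => h n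

lemma psum_nonneg {a : ArithmeticFunction ℝ} (h : ∀ n, 0 ≤ a n) (x : ℝ) : 0 ≤ psum a x :=
  sum_nonneg fun n _ => h n

lemma psum_add (a b : ArithmeticFunction ℝ) (x : ℝ) : psum (a + b) x = psum a x + psum b x := by
  simp [psum, sum_add_distrib]

lemma pmul_mul_distrib {w : ArithmeticFunction ℝ} (hw : ∀ m n, w (m * n) = w m * w n)
    (a b : ArithmeticFunction ℝ) : (a * b).pmul w = a.pmul w * b.pmul w := by
  ext n
  simp only [pmul_apply, mul_apply, sum_mul]
  refine sum_congr rfl fun p hp => ?_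
  rw [← (Nat.mem_divisorsAntidiagonal.1 hp).1, hw]
  ring

lemma pmul_log_mul (a b : ArithmeticFunction ℝ) :
    (a * b).pmul log = a.pmul log * b + a * b.pmul log := by
  ext n
  simp only [pmul_apply, mul_apply, ArithmeticFunction.add_apply, sum_mul]
  rw [← sum_add_distrib]
  refine sum_congr rfl fun p hp => ?_
  obtain ⟨h1, h2⟩ := Nat.mem_divisorsAntidiagonal.1 hp
  have h3 : p.1 ≠ 0 := by rintro h; simp [h] at h1; exact h2 h1.symm
  have h4 : p.2 ≠ 0 := by rintro h; simp [h] at h1; exact h2 h1.symm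
  rw [← h1]
  simp only [log_apply]
  push_cast
  rw [Real.log_mul (by exact_mod_cast h3) (by exact_mod_cast h4)]
  ring

lemma pmul_recip_mul (a b : ArithmeticFunction ℝ) :
    (a * b).pmul recip = a.pmul recip * b.pmul recip :=
  pmul_mul_distrib (fun m n => by simp [mul_comm]) a b

/-! ### Quadratic characters and the factorization g * f = 1 * χ -/

/-- A completely multiplicative function with values `0`, `1`, `-1`, whose partial sums lie
in `[0, 1]` and which vanishes at no prime other than `p₀`. -/
structure IsQuadChar (χ : ArithmeticFunction ℝ) (p₀ : ℕ) : Prop where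
  one : χ 1 = 1
  mul : ∀ m n, χ (m * n) = χ m * χ n
  vals : ∀ n, χ n = 0 ∨ χ n = 1 ∨ χ n = -1
  ram : ∀ p, p.Prime → χ p = 0 → p = p₀
  prime : p₀.Prime
  psum_nonneg : ∀ N : ℕ, 0 ≤ ∑ n ∈ Ioc 0 N, χ n
  psum_le_one : ∀ N : ℕ, ∑ n ∈ Ioc 0 N, χ n ≤ 1

open Classical in
/-- The indicator function of the positive integers all of whose prime factors split. -/
noncomputable def splitInd (χ : ArithmeticFunction ℝ) : ArithmeticFunction ℝ :=
  ⟨fun n => if n ≠ 0 ∧ ∀ p, p.Prime → p ∣ n → χ p = 1 then 1 else 0, by simp⟩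

open Classical in
/-- The indicator function of the positive integers in which all inert primes have even
exponent. -/
noncomputable def normInd (χ : ArithmeticFunction ℝ) : ArithmeticFunction ℝ :=
  ⟨fun n => if n ≠ 0 ∧ ∀ p, p.Prime → χ p = -1 → Even (n.factorization p) then 1 else 0, by simp⟩

open Classical in
lemma splitInd_apply (χ : ArithmeticFunction ℝ) (n : ℕ) :
    splitInd χ n = if n ≠ 0 ∧ ∀ p, p.Prime → p ∣ n → χ p = 1 then 1 else 0 := rfl

open Classical in
lemma normInd_apply (χ : ArithmeticFunction ℝ) (n : ℕ) :
    normInd χ n = if n ≠ 0 ∧ ∀ p, p.Prime → χ p = -1 → Even (n.factorization p) then 1 else 0 :=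
  rfl

lemma splitInd_nonneg (χ : ArithmeticFunction ℝ) (n : ℕ) : 0 ≤ splitInd χ n := by
  rw [splitInd_apply]; split_ifs <;> norm_num

lemma normInd_nonneg (χ : ArithmeticFunction ℝ) (n : ℕ) : 0 ≤ normInd χ n := by
  rw [normInd_apply]; split_ifs <;> norm_num

lemma normInd_le_one (χ : ArithmeticFunction ℝ) (n : ℕ) : normInd χ n ≤ 1 := by
  rw [normInd_apply]; split_ifs <;> norm_num

lemma splitInd_one (χ : ArithmeticFunction ℝ) : splitInd χ 1 = 1 := by
  rw [splitInd_apply, if_pos]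
  refine ⟨one_ne_zero, fun p hp h => ?_⟩
  exact absurd (Nat.dvd_one.1 h) hp.one_lt.ne'

lemma normInd_one (χ : ArithmeticFunction ℝ) : normInd χ 1 = 1 := by
  rw [normInd_apply, if_pos]; simp

lemma splitInd_mul (χ : ArithmeticFunction ℝ) (m n : ℕ) :
    splitInd χ (m * n) = splitInd χ m * splitInd χ n := by
  simp only [splitInd_apply]
  have : (m * n ≠ 0 ∧ ∀ p, p.Prime → p ∣ m * n → χ p = 1) ↔
      (m ≠ 0 ∧ ∀ p, p.Prime → p ∣ m → χ p = 1) ∧ (n ≠ 0 ∧ ∀ p, p.Prime → p ∣ n → χ p = 1) := by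
    constructor
    · rintro ⟨h1, h2⟩
      exact ⟨⟨left_ne_zero_of_mul h1, fun p hp h => h2 p hp (h.mul_right n)⟩,
        right_ne_zero_of_mul h1, fun p hp h => h2 p hp (h.mul_left m)⟩
    · rintro ⟨⟨h1, h2⟩, h3, h4⟩
      exact ⟨mul_ne_zero h1 h3, fun p hp h => (hp.dvd_mul.1 h).elim (h2 p hp) (h4 p hp)⟩
  by_cases h1 : (m ≠ 0 ∧ ∀ p, p.Prime → p ∣ m → χ p = 1) <;>
  by_cases h2 : (n ≠ 0 ∧ ∀ p, p.Prime → p ∣ n → χ p = 1)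
  · rw [if_pos (this.2 ⟨h1, h2⟩), if_pos h1, if_pos h2, mul_one]
  · rw [if_neg (fun h => h2 (this.1 h).2), if_pos h1, if_neg h2, mul_zero]
  · rw [if_neg (fun h => h1 (this.1 h).1), if_neg h1, zero_mul]
  · rw [if_neg (fun h => h1 (this.1 h).1), if_neg h1, zero_mul]

lemma splitInd_eq_one {χ : ArithmeticFunction ℝ} {n : ℕ} (h : splitInd χ n ≠ 0) :
    n ≠ 0 ∧ (∀ p, p.Prime → p ∣ n → χ p = 1) ∧ splitInd χ n = 1 := by
  rw [splitInd_apply] at *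
  split_ifs at * with h1
  · exact ⟨h1.1, h1.2, rfl⟩
  · simp at h

lemma normInd_eq_one {χ : ArithmeticFunction ℝ} {n : ℕ} (h : normInd χ n ≠ 0) :
    n ≠ 0 ∧ (∀ p, p.Prime → χ p = -1 → Even (n.factorization p)) ∧ normInd χ n = 1 := by
  rw [normInd_apply] at *
  split_ifs at * with h1
  · exact ⟨h1.1, h1.2, rfl⟩
  · simp at h

lemma normInd_eq_one_iff {χ : ArithmeticFunction ℝ} {n : ℕ} : normInd χ n = 1 ↔
    n ≠ 0 ∧ (∀ p, p.Prime → χ p = -1 → Even (n.factorization p)) := by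
  rw [normInd_apply]
  split_ifs with h1
  · simpa using h1
  · simpa using h1

lemma normInd_mul_of_even {χ : ArithmeticFunction ℝ} {m n : ℕ} (hm : m ≠ 0)
    (h : ∀ p, p.Prime → χ p = -1 → Even (m.factorization p)) :
    normInd χ (m * n) = normInd χ n := by
  have : (m * n ≠ 0 ∧ ∀ p, p.Prime → χ p = -1 → Even ((m * n).factorization p)) ↔
      (n ≠ 0 ∧ ∀ p, p.Prime → χ p = -1 → Even (n.factorization p)) := by
    rw [mul_ne_zero_iff_left hm]
    refine and_congr_right fun hn => forall₃_congr fun p hp hc => ?_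
    rw [Nat.factorization_mul hm hn, Finsupp.add_apply, Nat.even_add]
    simp [h p hp hc]
  simp only [normInd_apply]
  split_ifs with h1 h2 h2 <;> tauto

lemma normInd_split_mul {χ : ArithmeticFunction ℝ} {m n : ℕ} (hm : splitInd χ m ≠ 0) :
    normInd χ (m * n) = normInd χ n := by
  obtain ⟨h1, h2, -⟩ := splitInd_eq_one hm
  refine normInd_mul_of_even h1 fun p hp hc => ?_
  rw [Nat.factorization_eq_zero_of_not_dvd]
  · exact Even.zero
  · intro h
    have := h2 p hp h
    linarith

lemma normInd_sq_mul {χ : ArithmeticFunction ℝ} {m n : ℕ} (hm : m ≠ 0) :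
    normInd χ (m ^ 2 * n) = normInd χ n :=
  normInd_mul_of_even (pow_ne_zero 2 hm) fun p _ _ => by simp [Nat.factorization_pow]

lemma splitInd_le_normInd (χ : ArithmeticFunction ℝ) (n : ℕ) : splitInd χ n ≤ normInd χ n := by
  by_cases h : splitInd χ n = 0
  · rw [h]; exact normInd_nonneg χ n
  · have := normInd_split_mul (n := 1) h
    rw [mul_one, normInd_one] at this
    rw [this, (splitInd_eq_one h).2.2]

/-- The twist of the Möbius function inverse to `splitInd`. -/
noncomputable def splitMoebius (χ : ArithmeticFunction ℝ) : ArithmeticFunction ℝ :=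
  (μ : ArithmeticFunction ℝ).pmul (splitInd χ)

/-- Multiplying ζ * μ = 1 pointwise by the completely multiplicative `splitInd χ` respects
convolution. -/
lemma splitInd_mul_splitMoebius (χ : ArithmeticFunction ℝ) : splitInd χ * splitMoebius χ = 1 := by
  have h1 : splitInd χ = (ζ : ArithmeticFunction ℝ).pmul (splitInd χ) := by
    ext n
    simp
  unfold splitMoebius
  conv_lhs => enter [1]; rw [h1]
  rw [← pmul_mul_distrib (splitInd_mul χ), coe_zeta_mul_coe_moebius]
  ext n
  rcases eq_or_ne n 1 with rfl | hn
  · simp [splitInd_one]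
  · simp [hn]

/-- Keeps the sparse weight f in the error term of the Selberg-type identity; this is what makes the
later bootstrap possible. -/
lemma abs_splitMoebius_le (χ : ArithmeticFunction ℝ) (n : ℕ) :
    |splitMoebius χ n| ≤ normInd χ n := by
  refine le_trans ?_ (splitInd_le_normInd χ n)
  simp only [splitMoebius, pmul_apply, abs_mul, abs_of_nonneg (splitInd_nonneg χ n)]
  refine mul_le_of_le_one_left (splitInd_nonneg χ n) ?_
  rw [intCoe_apply, ← Int.cast_abs]
  exact_mod_cast abs_moebius_le_one

lemma isMultiplicative_splitInd (χ : ArithmeticFunction ℝ) : (splitInd χ).IsMultiplicative :=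
  ⟨splitInd_one χ, fun {m n} _ => splitInd_mul χ m n⟩

lemma isMultiplicative_normInd (χ : ArithmeticFunction ℝ) : (normInd χ).IsMultiplicative := by
  refine ⟨normInd_one χ, fun {m n} hmn => ?_⟩
  rcases eq_or_ne m 0 with rfl | hm
  · simp
  rcases eq_or_ne n 0 with rfl | hn
  · simp
  have : (m * n ≠ 0 ∧ ∀ p, p.Prime → χ p = -1 → Even ((m * n).factorization p)) ↔
      (m ≠ 0 ∧ ∀ p, p.Prime → χ p = -1 → Even (m.factorization p)) ∧
      (n ≠ 0 ∧ ∀ p, p.Prime → χ p = -1 → Even (n.factorization p)) := by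
    simp only [ne_eq, mul_eq_zero, hm, hn, or_self, not_false_eq_true, true_and,
      Nat.factorization_mul hm hn, Finsupp.add_apply]
    rw [← forall_and]
    refine forall_congr' fun p => ?_
    have : m.factorization p = 0 ∨ n.factorization p = 0 := by
      by_contra! h
      have h1 := Nat.dvd_of_factorization_pos h.1
      have h2 := Nat.dvd_of_factorization_pos h.2
      have h3 := Nat.dvd_gcd h1 h2
      rw [hmn] at h3
      rw [Nat.dvd_one.1 h3] at h
      simp at h
    rcases this with h | h <;> simp [h]
  simp only [normInd_apply]
  by_cases h1 : (m ≠ 0 ∧ ∀ p, p.Prime → χ p = -1 → Even (m.factorization p)) <;>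
  by_cases h2 : (n ≠ 0 ∧ ∀ p, p.Prime → χ p = -1 → Even (n.factorization p))
  · rw [if_pos (this.2 ⟨h1, h2⟩), if_pos h1, if_pos h2, mul_one]
  · rw [if_neg (fun h => h2 (this.1 h).2), if_neg h2, mul_zero]
  · rw [if_neg (fun h => h1 (this.1 h).1), if_neg h1, zero_mul]
  · rw [if_neg (fun h => h1 (this.1 h).1), if_neg h1, zero_mul]

section
variable {χ : ArithmeticFunction ℝ} {p₀ : ℕ}

lemma IsQuadChar.pow (hχ : IsQuadChar χ p₀) (m k : ℕ) : χ (m ^ k) = χ m ^ k := by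
  induction k with
  | zero => simp [hχ.one]
  | succ k ih => rw [pow_succ, hχ.mul, ih, pow_succ]

lemma splitInd_prime_pow_pos (χ : ArithmeticFunction ℝ) {p k : ℕ} (hp : p.Prime) (hk : k ≠ 0) :
    splitInd χ (p ^ k) = if χ p = 1 then 1 else 0 := by
  rw [splitInd_apply]
  congr 1
  simp only [eq_iff_iff]
  constructor
  · intro h; exact h.2 p hp (dvd_pow_self p hk)
  · intro h
    refine ⟨pow_ne_zero _ hp.ne_zero, fun q hq hqp => ?_⟩
    rw [(Nat.prime_dvd_prime_iff_eq hq hp).1 (hq.dvd_of_dvd_pow hqp)]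
    exact h

lemma normInd_prime_pow (χ : ArithmeticFunction ℝ) {p k : ℕ} (hp : p.Prime) :
    normInd χ (p ^ k) = if χ p = -1 ∧ ¬ Even k then 0 else 1 := by
  rw [normInd_apply, ← ite_not]
  congr 1
  simp only [eq_iff_iff]
  rw [not_iff_comm, not_and, not_not]
  constructor
  · intro h
    refine ⟨pow_ne_zero _ hp.ne_zero, fun q hq hqc => ?_⟩
    rw [hp.factorization_pow, Finsupp.single_apply]
    split_ifs with hpq
    · subst hpq; exact h hqc
    · exact Even.zero
  · intro h hc
    simpa [hp.factorization_pow] using h.2 p hp hc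

/-- The number of representations as a norm is the convolution of the two indicator functions. -/
lemma splitInd_mul_normInd (hχ : IsQuadChar χ p₀) :
    splitInd χ * normInd χ = (ζ : ArithmeticFunction ℝ) * χ := by
  have hm : χ.IsMultiplicative := ⟨hχ.one, fun {m n} _ => hχ.mul m n⟩
  rw [IsMultiplicative.eq_iff_eq_on_prime_powers _
    ((isMultiplicative_splitInd χ).mul (isMultiplicative_normInd χ)) _
    (isMultiplicative_zeta.natCast.mul hm)]
  intro p k hp
  rw [coe_zeta_mul_apply, Nat.sum_divisors_prime_pow hp, mul_apply,
    Nat.sum_divisorsAntidiagonal (fun i j => splitInd χ i * normInd χ j),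
    Nat.sum_divisors_prime_pow hp]
  have hdiv : ∀ i ∈ range (k + 1), p ^ k / p ^ i = p ^ (k - i) := fun i hi =>
    Nat.pow_div (by simpa [Nat.lt_succ_iff] using hi) hp.pos
  rw [sum_congr rfl fun i hi => by rw [hdiv i hi]]
  simp only [hχ.pow, normInd_prime_pow χ hp]
  -- The Euler factors match: a split prime contributes one geometric series to each of g and f,
  -- while ramified and inert primes contribute to f alone, the inert ones through even powers.
  rcases hχ.vals p with h | h | h
  · rw [sum_range_succ', sum_range_succ', sum_congr rfl (g := fun _ => (0 : ℝ)),
      sum_congr rfl (g := fun _ => (0 : ℝ))]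
    · simp [h, splitInd_one]
    · intro i _; simp
    · intro i _; rw [splitInd_prime_pow_pos χ hp (by lia)]; simp [h]
  · refine sum_congr rfl fun i _ => ?_
    have : ¬ ((1 : ℝ) = -1) := by norm_num
    rcases eq_or_ne i 0 with rfl | hi
    · simp [h, splitInd_one, this]
    · rw [splitInd_prime_pow_pos χ hp hi]; simp [h, this]
  · rw [sum_range_succ', sum_congr rfl (g := fun _ => (0 : ℝ))]
    · simp only [h, sum_const_zero, pow_zero, splitInd_one, true_and, Nat.sub_zero, zero_add,
        one_mul]
      rw [neg_one_geom_sum]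
      by_cases hk : Even k
      · rw [if_neg (by simpa using hk), if_neg (by simpa [Nat.even_add_one] using hk)]
      · rw [if_pos hk, if_pos (by simpa [Nat.even_add_one] using hk)]
    · intro i _
      rw [splitInd_prime_pow_pos χ hp (by lia)]
      have : ¬ ((-1 : ℝ) = 1) := by norm_num
      simp [h, this]
end

/-! ### Logarithmic derivatives and the nonsplit remainder -/

/-- The von Mangoldt function restricted to powers of split primes. -/
noncomputable def splitLambda (χ : ArithmeticFunction ℝ) : ArithmeticFunction ℝ :=
  vonMangoldt.pmul (splitInd χ)

lemma splitInd_pmul_log (χ : ArithmeticFunction ℝ) :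
    (splitInd χ).pmul log = splitInd χ * splitLambda χ := by
  have h1 : (ζ : ArithmeticFunction ℝ).pmul (splitInd χ) = splitInd χ := by
    ext n
    simp
  rw [← vonMangoldt_mul_zeta, pmul_comm, pmul_mul_distrib (splitInd_mul χ), h1, mul_comm]
  rfl

/-- The contribution of the prime powers that do not split to `f log`. -/
noncomputable def nonsplitLog (χ : ArithmeticFunction ℝ) : ArithmeticFunction ℝ :=
  (normInd χ).pmul log - normInd χ * splitLambda χ

/-- Multiplication by log is a derivation, and g log = g * Λg. Cancelling g leaves f log + f * Λg,
which is 2 f log minus the nonsplit remainder. -/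
lemma splitMoebius_mul_pmul_log (χ : ArithmeticFunction ℝ) :
    splitMoebius χ * (splitInd χ * normInd χ).pmul log =
      (normInd χ).pmul log + (normInd χ).pmul log - nonsplitLog χ := by
  have h : splitMoebius χ * splitInd χ = 1 := by rw [mul_comm, splitInd_mul_splitMoebius]
  rw [pmul_log_mul, splitInd_pmul_log, nonsplitLog, mul_add, ← mul_assoc, ← mul_assoc, h,
    ← mul_assoc, h]
  ring

/-- The function `Λ(l)` placed at the square `l ^ 2`. -/
noncomputable def lambdaSq : ArithmeticFunction ℝ :=
  ⟨fun k => if k.sqrt ^ 2 = k then Λ k.sqrt else 0, by simp⟩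

lemma lambdaSq_apply (k : ℕ) : lambdaSq k = if k.sqrt ^ 2 = k then Λ k.sqrt else 0 := rfl

lemma lambdaSq_nonneg (k : ℕ) : 0 ≤ lambdaSq k := by
  rw [lambdaSq_apply]; split_ifs
  · exact vonMangoldt_nonneg
  · exact le_rfl

lemma lambdaSq_sq (l : ℕ) : lambdaSq (l ^ 2) = Λ l := by
  rw [lambdaSq_apply, Nat.sqrt_eq']; simp

lemma psum_lambdaSq_le (y : ℝ) : psum lambdaSq y ≤ Chebyshev.psi √y := by
  rw [psum, Chebyshev.psi, ← sum_filter_ne_zero]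
  have : ∑ l ∈ Ioc 0 ⌊√y⌋₊, Λ l = ∑ k ∈ (Ioc 0 ⌊√y⌋₊).image (· ^ 2), lambdaSq k := by
    rw [sum_image (fun a _ b _ h => by simpa using h)]
    exact sum_congr rfl fun l _ => (lambdaSq_sq l).symm
  rw [this]
  refine sum_le_sum_of_subset_of_nonneg (fun k hk => ?_) fun k _ _ => lambdaSq_nonneg k
  rw [mem_filter, mem_Ioc, lambdaSq_apply] at hk
  obtain ⟨⟨h1, h2⟩, h3⟩ := hk
  have h4 : k.sqrt ^ 2 = k := by by_contra h; simp [h] at h3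
  rw [mem_image]
  refine ⟨k.sqrt, mem_Ioc.2 ⟨Nat.sqrt_pos.2 h1, Nat.le_floor ?_⟩, h4⟩
  refine Real.le_sqrt_of_sq_le ?_
  rw [← Nat.cast_pow, h4]
  exact (Nat.le_floor_iff' h1.ne').1 h2

section
variable {χ : ArithmeticFunction ℝ} {p₀ : ℕ}

/-- Removing a divisor made of split primes does not change f, so the factor f(m) comes out of the
convolution. -/
lemma normInd_mul_splitLambda_apply (χ : ArithmeticFunction ℝ) (m : ℕ) :
    (normInd χ * splitLambda χ) m = normInd χ m * ∑ k ∈ m.divisors, splitLambda χ k := by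
  rw [mul_comm, mul_apply, Nat.sum_divisorsAntidiagonal (fun i j => splitLambda χ i * normInd χ j),
    mul_sum]
  refine sum_congr rfl fun k hk => ?_
  obtain ⟨c, rfl⟩ := Nat.dvd_of_mem_divisors hk
  by_cases h : splitInd χ k = 0
  · simp [splitLambda, h]
  · rw [normInd_split_mul h, mul_comm, Nat.mul_div_cancel_left _
      (Nat.pos_of_ne_zero (splitInd_eq_one h).1)]

lemma nonsplitLog_apply (χ : ArithmeticFunction ℝ) (m : ℕ) :
    nonsplitLog χ m = normInd χ m * (Real.log m - ∑ k ∈ m.divisors, splitLambda χ k) := by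
  rw [nonsplitLog, sub_eq_add_neg, ArithmeticFunction.add_apply, ArithmeticFunction.neg_apply,
    normInd_mul_splitLambda_apply, pmul_apply, log_apply]
  ring

lemma splitLambda_le (χ : ArithmeticFunction ℝ) (k : ℕ) : splitLambda χ k ≤ Λ k := by
  rw [splitLambda, pmul_apply]
  exact mul_le_of_le_one_right vonMangoldt_nonneg
    ((splitInd_le_normInd χ k).trans (normInd_le_one χ k))

lemma splitLambda_nonneg (χ : ArithmeticFunction ℝ) (k : ℕ) : 0 ≤ splitLambda χ k :=
  mul_nonneg vonMangoldt_nonneg (splitInd_nonneg χ k)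

lemma nonsplitLog_nonneg (χ : ArithmeticFunction ℝ) (m : ℕ) : 0 ≤ nonsplitLog χ m := by
  rw [nonsplitLog_apply, ← vonMangoldt_sum, ← sum_sub_distrib]
  exact mul_nonneg (normInd_nonneg χ m) (sum_nonneg fun k _ => sub_nonneg.2 (splitLambda_le χ k))

lemma not_inert_of_squarefree {a b p : ℕ} (ha : Squarefree a)
    (hf : normInd χ (b ^ 2 * a) = 1) (hp : p.Prime) (hpa : p ∣ a) : χ p ≠ -1 := by
  obtain ⟨h0, h⟩ := normInd_eq_one_iff.1 hf
  have ha0 := right_ne_zero_of_mul h0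
  have hb0 := left_ne_zero_of_mul h0
  intro hc
  have h1 := h p hp hc
  have h2 : a.factorization p = 1 := by
    have h3 := ha.natFactorization_le_one p
    have h4 := hp.factorization_pos_of_dvd ha0 hpa
    lia
  rw [Nat.factorization_mul hb0 ha0, Finsupp.add_apply, h2, Nat.factorization_pow] at h1
  simp at h1

/-- Write m = b²a with a squarefree. If f(m) = 1, no inert prime divides a, so log a is all split
except possibly for log p₀. The part 2 log b is 2 ∑ Λ(l) over l ∣ b, and each such l² divides m with
a cofactor on which f is 1. -/
lemma nonsplitLog_le (hχ : IsQuadChar χ p₀) (m : ℕ) :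
    nonsplitLog χ m ≤ normInd χ m * Real.log p₀ + 2 * (normInd χ * lambdaSq) m := by
  have hlog : 0 ≤ Real.log p₀ := Real.log_natCast_nonneg _
  have hconv : 0 ≤ (normInd χ * lambdaSq) m := by
    rw [mul_apply]
    exact sum_nonneg fun p _ => mul_nonneg (normInd_nonneg χ _) (lambdaSq_nonneg _)
  by_cases hf : normInd χ m = 0
  · rw [nonsplitLog_apply, hf]; linarith
  replace hf := (normInd_eq_one hf).2.2
  have hm : m ≠ 0 := (normInd_eq_one_iff.1 hf).1
  obtain ⟨a, b, hab, ha⟩ := Nat.sq_mul_squarefree m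
  have ha0 : a ≠ 0 := ha.ne_zero
  have hb0 : b ≠ 0 := by rintro rfl; simp at hab; exact hm hab.symm
  have h1 : Real.log m = 2 * ∑ l ∈ b.divisors, Λ l + ∑ k ∈ a.divisors, Λ k := by
    rw [vonMangoldt_sum, vonMangoldt_sum, ← hab]
    push_cast
    rw [Real.log_mul (by positivity) (by positivity), Real.log_pow]
    norm_num
  have h2 : ∑ k ∈ a.divisors, splitLambda χ k ≤ ∑ k ∈ m.divisors, splitLambda χ k :=
    sum_le_sum_of_subset_of_nonneg (Nat.divisors_subset_of_dvd hm (hab ▸ dvd_mul_left _ _))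
      fun k _ _ => splitLambda_nonneg χ k
  have h3 : ∑ k ∈ a.divisors, (Λ k - splitLambda χ k) ≤ Real.log p₀ := by
    calc ∑ k ∈ a.divisors, (Λ k - splitLambda χ k)
        ≤ ∑ k ∈ a.divisors, if k = p₀ then Real.log p₀ else 0 := by
          refine sum_le_sum fun k hk => ?_
          have hka := Nat.dvd_of_mem_divisors hk
          by_cases hΛ : Λ k = 0
          · have := splitLambda_nonneg χ k
            rw [hΛ]; split_ifs <;> linarith
          · obtain ⟨p, j, hp, hj, rfl⟩ := (isPrimePow_nat_iff _).1 (vonMangoldt_ne_zero_iff.1 hΛ)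
            have hj1 : j = 1 := by
              by_contra hj1
              have : p ^ 2 ∣ a := (pow_dvd_pow p (by lia)).trans hka
              rw [sq] at this
              have := ha p this
              exact hp.one_lt.ne' (Nat.isUnit_iff.1 this)
            subst hj1
            rw [pow_one] at *
            rw [splitLambda, pmul_apply]
            have hsp := splitInd_prime_pow_pos χ hp one_ne_zero
            rw [pow_one] at hsp
            rw [hsp]
            rcases hχ.vals p with h | h | h
            · have := hχ.ram p hp h
              subst this
              rw [vonMangoldt_apply_prime hp]; simp [h]
            · simp only [h, if_true, mul_one, sub_self]
              split_ifs <;> linarith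
            · exact absurd h (not_inert_of_squarefree ha (by rw [hab]; exact hf) hp hka)
      _ ≤ Real.log p₀ := by
          rw [sum_ite_eq']; split_ifs <;> linarith
  have h4 : ∑ l ∈ b.divisors, Λ l ≤ (normInd χ * lambdaSq) m := by
    rw [mul_comm, mul_apply, Nat.sum_divisorsAntidiagonal (fun i j => lambdaSq i * normInd χ j)]
    calc ∑ l ∈ b.divisors, Λ l
        = ∑ k ∈ b.divisors.image (· ^ 2), lambdaSq k * normInd χ (m / k) := by
          rw [sum_image (fun a _ b _ h => by simpa using h)]
          refine sum_congr rfl fun l hl => ?_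
          obtain ⟨c, rfl⟩ := Nat.dvd_of_mem_divisors hl
          have hl0 : l ≠ 0 := left_ne_zero_of_mul hb0
          have hm2 : m = l ^ 2 * (c ^ 2 * a) := by rw [← hab]; ring
          rw [lambdaSq_sq, hm2, Nat.mul_div_cancel_left _ (by positivity)]
          rw [hm2, normInd_sq_mul hl0] at hf
          rw [hf, mul_one]
      _ ≤ _ := by
          refine sum_le_sum_of_subset_of_nonneg (fun k hk => ?_) fun k _ _ =>
            mul_nonneg (lambdaSq_nonneg k) (normInd_nonneg χ _)
          obtain ⟨l, hl, rfl⟩ := mem_image.1 hk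
          refine Nat.mem_divisors.2 ⟨?_, hm⟩
          rw [← hab]
          exact (pow_dvd_pow_of_dvd (Nat.dvd_of_mem_divisors hl) 2).mul_right a
  rw [sum_sub_distrib] at h3
  rw [nonsplitLog_apply, hf, h1]
  linarith

lemma psum_nonsplitLog_le (hχ : IsQuadChar χ p₀) (x : ℝ) :
    psum (nonsplitLog χ) x ≤
      ∑ n ∈ Ioc 0 ⌊x⌋₊, normInd χ n * (Real.log p₀ + 2 * Chebyshev.psi √(x / n)) := by
  calc psum (nonsplitLog χ) x
      ≤ ∑ m ∈ Ioc 0 ⌊x⌋₊, (normInd χ m * Real.log p₀ + 2 * (normInd χ * lambdaSq) m) :=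
        sum_le_sum fun m _ => nonsplitLog_le hχ m
    _ = ∑ n ∈ Ioc 0 ⌊x⌋₊, (normInd χ n * Real.log p₀ + 2 * (normInd χ n * psum lambdaSq (x / n)))
        := by
        rw [sum_add_distrib, sum_add_distrib, ← mul_sum, ← mul_sum, ← psum_mul, psum]
    _ ≤ _ := by
        refine sum_le_sum fun n _ => ?_
        have h1 := psum_lambdaSq_le (x / n)
        have h2 := mul_le_mul_of_nonneg_left h1 (normInd_nonneg χ n)
        linarith
end

/-! ### The hyperbola method and the value L(1, χ) -/

lemma sum_mul_div_hyperbola (c : ℕ → ℝ) {N D : ℕ} (h1 : D * D ≤ N) (h2 : N < (D + 1) * (D + 1)) :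
    ∑ d ∈ Ioc 0 N, c d * ((N / d : ℕ) : ℝ) = ∑ d ∈ Ioc 0 D, c d * ((N / d : ℕ) : ℝ) +
      ∑ m ∈ Ioc 0 D, (∑ d ∈ Ioc 0 (N / m), c d - ∑ d ∈ Ioc 0 D, c d) := by
  have hDN : D ≤ N := by nlinarith
  rw [← sum_Ioc_consecutive _ (Nat.zero_le D) hDN]
  congr 1
  have h3 : ∀ d ∈ Ioc D N, c d * ((N / d : ℕ) : ℝ) = ∑ m ∈ Ioc 0 D, if m * d ≤ N then c d else 0 := by
    intro d hd
    rw [mem_Ioc] at hd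
    rw [← sum_filter, sum_const, nsmul_eq_mul, mul_comm]
    congr 2
    have : {m ∈ Ioc 0 D | m * d ≤ N} = Ioc 0 (N / d) := by
      ext m
      simp only [mem_filter, mem_Ioc]
      rw [Nat.le_div_iff_mul_le (by lia)]
      constructor
      · rintro ⟨⟨h, -⟩, h'⟩; exact ⟨h, h'⟩
      · rintro ⟨h, h'⟩
        refine ⟨⟨h, ?_⟩, h'⟩
        by_contra! hm
        have : (D + 1) * (D + 1) ≤ m * d := Nat.mul_le_mul hm hd.1
        lia
    rw [this, Nat.card_Ioc, Nat.sub_zero]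
  rw [sum_congr rfl h3, sum_comm]
  refine sum_congr rfl fun m hm => ?_
  rw [mem_Ioc] at hm
  have hDm : D ≤ N / m := by
    rw [Nat.le_div_iff_mul_le hm.1]
    exact (Nat.mul_le_mul_left D hm.2).trans h1
  rw [← sum_Ioc_consecutive _ (Nat.zero_le D) hDm, add_sub_cancel_left, ← sum_filter]
  refine sum_congr ?_ fun _ _ => rfl
  ext d
  simp only [mem_filter, mem_Ioc]
  rw [Nat.le_div_iff_mul_le hm.1, mul_comm d m]
  constructor
  · rintro ⟨⟨h, -⟩, h'⟩; exact ⟨h, h'⟩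
  · rintro ⟨h, h'⟩
    exact ⟨⟨h, (Nat.le_mul_of_pos_left d hm.1).trans h'⟩, h'⟩

/-- Lower approximations to the value at `1` of the `L`-series of `χ`. -/
noncomputable def lowerL (χ : ArithmeticFunction ℝ) (N : ℕ) : ℝ :=
  ∑ n ∈ Ioc 0 N, χ n / n - (∑ n ∈ Ioc 0 N, χ n) / (N + 1)

/-- The value at `1` of the `L`-series of `χ`. -/
noncomputable def valL (χ : ArithmeticFunction ℝ) : ℝ := ⨆ N, lowerL χ N

section
variable {χ : ArithmeticFunction ℝ} {p₀ : ℕ}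

/-- By Abel summation `lowerL χ N` is ∑ X(n)/(n(n+1)) over n ≤ N, where X(n) is the partial sum of
χ, and X ≥ 0. The companion upper bound uses 1 - X ≥ 0 in the same way. -/
lemma lowerL_monotone (hχ : IsQuadChar χ p₀) : Monotone (lowerL χ) := by
  refine monotone_nat_of_le_succ fun N => ?_
  have h := hχ.psum_nonneg (N + 1)
  unfold lowerL
  rw [sum_Ioc_succ_top (Nat.zero_le N), sum_Ioc_succ_top (Nat.zero_le N)] at *
  set X := ∑ n ∈ Ioc 0 N, χ n
  push_cast
  have h1 : (X + χ (N + 1)) / ((N : ℝ) + 1 + 1) ≤ (X + χ (N + 1)) / ((N : ℝ) + 1) :=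
    div_le_div_of_nonneg_left h (by positivity) (by linarith)
  rw [add_div (c := (N : ℝ) + 1)] at h1
  linarith

lemma upperL_antitone (hχ : IsQuadChar χ p₀) :
    Antitone fun N : ℕ => lowerL χ N + 1 / ((N : ℝ) + 1) := by
  refine antitone_nat_of_succ_le fun N => ?_
  have h := hχ.psum_le_one (N + 1)
  unfold lowerL
  rw [sum_Ioc_succ_top (Nat.zero_le N), sum_Ioc_succ_top (Nat.zero_le N)] at *
  set X := ∑ n ∈ Ioc 0 N, χ n
  push_cast
  have h1 : (1 - (X + χ (N + 1))) / ((N : ℝ) + 1 + 1) ≤ (1 - (X + χ (N + 1))) / ((N : ℝ) + 1) :=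
    div_le_div_of_nonneg_left (by linarith) (by positivity) (by linarith)
  rw [sub_div, sub_div, add_div (c := (N : ℝ) + 1)] at h1
  linarith

lemma lowerL_le_upperL (hχ : IsQuadChar χ p₀) (M N : ℕ) :
    lowerL χ M ≤ lowerL χ N + 1 / ((N : ℝ) + 1) := by
  have h1 := lowerL_monotone hχ (le_max_left M N)
  have h2 := upperL_antitone hχ (le_max_right M N)
  have h3 : 0 ≤ 1 / (((max M N : ℕ) : ℝ) + 1) := by positivity
  simp only at h2
  linarith

lemma lowerL_le_valL (hχ : IsQuadChar χ p₀) (N : ℕ) : lowerL χ N ≤ valL χ :=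
  le_ciSup ⟨_, by rintro _ ⟨M, rfl⟩; exact lowerL_le_upperL hχ M 0⟩ N

lemma valL_le_upperL (hχ : IsQuadChar χ p₀) (N : ℕ) : valL χ ≤ lowerL χ N + 1 / ((N : ℝ) + 1) :=
  ciSup_le fun M => lowerL_le_upperL hχ M N

lemma psum_zeta_mul (y : ℝ) :
    psum ((ζ : ArithmeticFunction ℝ) * χ) y = ∑ d ∈ Ioc 0 ⌊y⌋₊, χ d * ((⌊y⌋₊ / d : ℕ) : ℝ) := by
  rw [mul_comm, psum, sum_Ioc_mul_zeta_eq_sum]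

lemma IsQuadChar.abs_le_one (hχ : IsQuadChar χ p₀) (n : ℕ) : |χ n| ≤ 1 := by
  rcases hχ.vals n with h | h | h <;> rw [h] <;> norm_num

/-- The summatory function of `1 * χ` by the hyperbola method. -/
lemma abs_psum_zeta_mul_sub_le (hχ : IsQuadChar χ p₀) {y : ℝ} (hy : 0 ≤ y) :
    |psum ((ζ : ArithmeticFunction ℝ) * χ) y - valL χ * y| ≤ 2 * √y := by
  set N := ⌊y⌋₊ with hN
  set D := N.sqrt with hD
  have hNy : (N : ℝ) ≤ y := Nat.floor_le hy
  have hyN : y < N + 1 := Nat.lt_floor_add_one y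
  have h1 : D * D ≤ N := Nat.sqrt_le N
  have h2 : N < (D + 1) * (D + 1) := Nat.lt_succ_sqrt N
  have hDy : (D : ℝ) ≤ √y := by
    refine Real.le_sqrt_of_sq_le ?_
    have : ((D * D : ℕ) : ℝ) ≤ N := by exact_mod_cast h1
    push_cast at this
    nlinarith
  have hyD : √y ≤ D + 1 := by
    refine Real.sqrt_le_iff.2 ⟨by positivity, ?_⟩
    have : (N : ℝ) + 1 ≤ (D + 1) * (D + 1) := by exact_mod_cast h2
    nlinarith
  rw [psum_zeta_mul, ← hN, sum_mul_div_hyperbola _ h1 h2]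
  have hA := lowerL_le_valL hχ D
  have hB := valL_le_upperL hχ D
  unfold lowerL at hA hB
  set X := ∑ n ∈ Ioc 0 D, χ n with hX
  have hX0 : 0 ≤ X := hχ.psum_nonneg D
  have hX1 : X ≤ 1 := hχ.psum_le_one D
  set S := ∑ n ∈ Ioc 0 D, χ n / n with hS
  have hfrac : |∑ d ∈ Ioc 0 D, χ d * ((N / d : ℕ) : ℝ) - y * S| ≤ D := by
    rw [hS, mul_sum, ← sum_sub_distrib]
    refine (abs_sum_le_sum_abs _ _).trans ?_
    calc ∑ d ∈ Ioc 0 D, |χ d * ((N / d : ℕ) : ℝ) - y * (χ d / d)| ≤ ∑ d ∈ Ioc 0 D, (1 : ℝ) := by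
          refine sum_le_sum fun d hd => ?_
          have hd0 : (0 : ℝ) < d := by exact_mod_cast (mem_Ioc.1 hd).1
          have e : χ d * ((N / d : ℕ) : ℝ) - y * (χ d / d) = χ d * (((N / d : ℕ) : ℝ) - y / d) := by
            ring
          rw [e, abs_mul]
          refine mul_le_one₀ (hχ.abs_le_one d) (abs_nonneg _) ?_
          rw [hN, ← Nat.floor_div_natCast]
          have := Nat.floor_le (div_nonneg hy hd0.le)
          have := Nat.lt_floor_add_one (y / d)
          rw [abs_le]; constructor <;> linarith
      _ = D := by simp
  have hup : ∑ m ∈ Ioc 0 D, (∑ d ∈ Ioc 0 (N / m), χ d - X) ≤ D * (1 - X) := by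
    calc _ ≤ ∑ m ∈ Ioc 0 D, (1 - X) := sum_le_sum fun m _ => by linarith [hχ.psum_le_one (N / m)]
      _ = _ := by simp; ring
  have hlow : D * (-X) ≤ ∑ m ∈ Ioc 0 D, (∑ d ∈ Ioc 0 (N / m), χ d - X) := by
    calc _ = ∑ m ∈ Ioc 0 D, (-X) := by simp
      _ ≤ _ := sum_le_sum fun m _ => by linarith [hχ.psum_nonneg (N / m)]
  have hyD' : y / (D + 1) ≤ √y := by
    rw [div_le_iff₀ (by positivity)]
    nlinarith [Real.mul_self_sqrt hy, Real.sqrt_nonneg y]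
  have hq : 0 ≤ y / (D + 1) := by positivity
  have hA' : y * S - valL χ * y ≤ X * (y / (D + 1)) := by
    have := mul_le_mul_of_nonneg_right hA hy
    have e : (S - X / (D + 1)) * y = y * S - X * (y / (D + 1)) := by ring
    linarith
  have hB' : valL χ * y - y * S ≤ (1 - X) * (y / (D + 1)) := by
    have := mul_le_mul_of_nonneg_right hB hy
    have e : (S - X / (D + 1) + 1 / (D + 1)) * y = y * S + (1 - X) * (y / (D + 1)) := by ring
    linarith
  rw [abs_le] at hfrac ⊢
  -- In each direction the truncation of L and the second hyperbola sum carry complementary weights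
  -- X and 1 - X. Together they cost one √y; the fractional parts cost the other.
  have k1 := mul_le_mul_of_nonneg_left hyD' hX0
  have k2 := mul_le_mul_of_nonneg_left hyD' (sub_nonneg.2 hX1)
  have k3 := mul_le_mul_of_nonneg_left hDy hX0
  have k4 := mul_le_mul_of_nonneg_left hDy (sub_nonneg.2 hX1)
  constructor <;> nlinarith
end

/-! ### Abel summation against 1/n and log n -/

lemma sum_Icc_zero_eq (a : ArithmeticFunction ℝ) (N : ℕ) :
    ∑ k ∈ Icc 0 N, a k = ∑ k ∈ Ioc 0 N, a k := by
  rw [← add_sum_Ioc_eq_sum_Icc (Nat.zero_le N)]; simp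

lemma measurable_psum (a : ArithmeticFunction ℝ) : Measurable (psum a) :=
  (measurable_from_nat (f := fun N => ∑ n ∈ Ioc 0 N, a n)).comp Nat.measurable_floor

/-- Abel summation against a differentiable weight. -/
lemma psum_pmul_eq (a w : ArithmeticFunction ℝ) {g g' : ℝ → ℝ} (hw : ∀ n, w n = g n)
    (hg : ∀ t : ℝ, 1 ≤ t → HasDerivAt g (g' t) t) (hg' : ContinuousOn g' (Set.Ici 1))
    (y : ℝ) :
    psum (a.pmul w) y = g y * psum a y - ∫ t in Set.Ioc 1 y, g' t * psum a t := by
  have hder : ∀ t : ℝ, 1 ≤ t → deriv g t = g' t := fun t ht => (hg t ht).deriv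
  have h := sum_mul_eq_sub_integral_mul₀ (fun n => a n) (f := g) (by simp) y
    (fun t ht => (hg t ht.1).differentiableAt)
    (((hg'.mono Set.Icc_subset_Ici_self).congr fun t ht => hder t ht.1).integrableOn_Icc)
  rw [← add_sum_Ioc_eq_sum_Icc (Nat.zero_le _)] at h
  simp only [sum_Icc_zero_eq, ArithmeticFunction.map_zero, mul_zero, zero_add] at h
  have h2 : psum (a.pmul w) y = ∑ k ∈ Ioc 0 ⌊y⌋₊, g k * a k := by
    unfold psum
    exact sum_congr rfl fun k _ => by rw [pmul_apply, hw, mul_comm]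
  rw [h2, h]
  congr 1
  refine setIntegral_congr_fun measurableSet_Ioc fun t ht => ?_
  simp only [hder t ht.1.le, psum]

lemma integrableOn_Ioc_of_abs_le {e : ℝ → ℝ} {c a y : ℝ} (he : Measurable e)
    (h : ∀ t ∈ Set.Ioc a y, |e t| ≤ c) : IntegrableOn e (Set.Ioc a y) := by
  refine Measure.integrableOn_of_bounded (M := c) (by simp) he.aestronglyMeasurable ?_
  filter_upwards [ae_restrict_mem measurableSet_Ioc] with t ht
  exact h t ht

section
variable {e : ℝ → ℝ} {c : ℝ}

lemma abs_div_sq_le (h : ∀ t, 0 ≤ t → |e t| ≤ c * √t) {t : ℝ} (ht : 0 < t) :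
    |e t / t ^ 2| ≤ c * t ^ (-(3 / 2) : ℝ) := by
  have e1 : √t / t ^ 2 = t ^ (-(3 / 2) : ℝ) := by
    rw [Real.sqrt_eq_rpow, ← Real.rpow_natCast, ← Real.rpow_sub ht]; norm_num
  rw [abs_div, abs_of_pos (by positivity : 0 < t ^ 2), ← e1, ← mul_div_assoc]
  gcongr
  exact h t ht.le

lemma integrableOn_Ioi_div_sq (he : Measurable e) (h : ∀ t, 0 ≤ t → |e t| ≤ c * √t) {y : ℝ}
    (hy : 0 < y) : IntegrableOn (fun t => e t / t ^ 2) (Set.Ioi y) := by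
  refine Integrable.mono' ((integrableOn_Ioi_rpow_of_lt (by norm_num : (-(3 / 2) : ℝ) < -1) hy).const_mul c)
    (he.div (measurable_id.pow_const 2)).aestronglyMeasurable ?_
  filter_upwards [ae_restrict_mem measurableSet_Ioi] with t ht
  exact abs_div_sq_le h (hy.trans ht)

lemma abs_integral_Ioi_div_sq_le (h : ∀ t, 0 ≤ t → |e t| ≤ c * √t) {y : ℝ}
    (hy : 0 < y) : |∫ t in Set.Ioi y, e t / t ^ 2| ≤ 2 * c / √y := by
  have h1 : ∫ t in Set.Ioi y, c * t ^ (-(3 / 2) : ℝ) = 2 * c / √y := by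
    rw [integral_const_mul, integral_Ioi_rpow_of_lt (by norm_num) hy, Real.sqrt_eq_rpow]
    norm_num
    rw [Real.rpow_neg hy.le]
    ring
  rw [← h1, ← Real.norm_eq_abs]
  refine norm_integral_le_of_norm_le
    ((integrableOn_Ioi_rpow_of_lt (by norm_num : (-(3 / 2) : ℝ) < -1) hy).const_mul c) ?_
  filter_upwards [ae_restrict_mem measurableSet_Ioi] with t ht
  exact abs_div_sq_le h (hy.trans ht)

lemma abs_integral_Ioc_div_le (h : ∀ t, 0 ≤ t → |e t| ≤ c * √t) (hc : 0 ≤ c) {y : ℝ}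
    (hy : 1 ≤ y) : |∫ t in Set.Ioc 1 y, e t / t| ≤ 2 * c * √y := by
  have h0 : ∀ t ∈ Set.Ioc 1 y, ‖e t / t‖ ≤ c * t ^ (-(1 / 2) : ℝ) := by
    intro t ht
    have ht0 : 0 < t := one_pos.trans ht.1
    have e1 : √t / t = t ^ (-(1 / 2) : ℝ) := by
      nth_rw 2 [← Real.rpow_one t]
      rw [Real.sqrt_eq_rpow, ← Real.rpow_sub ht0]; norm_num
    rw [Real.norm_eq_abs, abs_div, abs_of_pos ht0, ← e1, ← mul_div_assoc]
    gcongr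
    exact h t ht0.le
  have h2 : ∫ t in (1 : ℝ)..y, c * t ^ (-(1 / 2) : ℝ) = c * (2 * (√y - 1)) := by
    rw [intervalIntegral.integral_const_mul, integral_rpow (Or.inl (by norm_num)),
      Real.sqrt_eq_rpow]
    norm_num
    left
    ring
  rw [intervalIntegral.integral_of_le hy] at h2
  have h3 : IntegrableOn (fun t : ℝ => c * t ^ (-(1 / 2) : ℝ)) (Set.Ioc 1 y) :=
    ((intervalIntegral.intervalIntegrable_rpow' (by norm_num)).1).const_mul c
  rw [← Real.norm_eq_abs]
  refine (norm_integral_le_of_norm_le h3 ?_).trans ?_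
  · filter_upwards [ae_restrict_mem measurableSet_Ioc] with t ht
    exact h0 t ht
  · rw [h2]; nlinarith
end

section
variable {r : ArithmeticFunction ℝ} {L c : ℝ}

lemma measurable_psum_sub (r : ArithmeticFunction ℝ) (L : ℝ) :
    Measurable fun t => psum r t - L * t :=
  (measurable_psum r).sub (measurable_const.mul measurable_id)

/-- `∑ r(k)/k = L log y + C + O(1/√y)` when `∑ r(k) = L y + O(√y)`. -/
lemma exists_psum_recip_approx (h : ∀ t, 0 ≤ t → |psum r t - L * t| ≤ c * √t) :
    ∃ C, |C - L| ≤ 2 * c ∧ ∀ y, 1 ≤ y →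
      |psum (r.pmul recip) y - L * Real.log y - C| ≤ 3 * c / √y := by
  set e : ℝ → ℝ := fun t => psum r t - L * t with he
  have hem : Measurable e := measurable_psum_sub r L
  -- The boundary term contributes L, and the convergent error integral is completed to infinity;
  -- its tail joins the O(1/√y).
  refine ⟨L + ∫ t in Set.Ioi 1, e t / t ^ 2, ?_, fun y hy => ?_⟩
  · have := abs_integral_Ioi_div_sq_le (e := e) h one_pos
    simpa using this
  have hy0 : 0 < y := one_pos.trans_le hy
  have h1 := psum_pmul_eq r recip (g := fun t => t⁻¹) (g' := fun t => -(t ^ 2)⁻¹) (fun n => rfl)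
    (fun t ht => hasDerivAt_inv (by linarith)) (by
      refine ContinuousOn.neg (ContinuousOn.inv₀ (by fun_prop) fun t ht => ?_)
      have : (1 : ℝ) ≤ t := ht
      positivity) y
  have hI := integrableOn_Ioi_div_sq hem h one_pos
  have h2 : ∫ t in Set.Ioc 1 y, -(t ^ 2)⁻¹ * psum r t =
      -(L * Real.log y + ∫ t in Set.Ioc 1 y, e t / t ^ 2) := by
    have hinv : IntegrableOn (fun t : ℝ => L * t⁻¹) (Set.Ioc 1 y) := by
      have hc : ContinuousOn (fun t : ℝ => t⁻¹) (Set.Icc 1 y) :=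
        ContinuousOn.inv₀ continuousOn_id fun t ht => by have := ht.1; simp; linarith
      exact Integrable.const_mul (hc.integrableOn_Icc.mono_set Set.Ioc_subset_Icc_self) L
    rw [show L * Real.log y = ∫ t in Set.Ioc 1 y, L * t⁻¹ by
      rw [← intervalIntegral.integral_of_le hy, intervalIntegral.integral_const_mul,
        integral_inv_of_pos one_pos hy0, div_one],
      ← integral_add hinv (hI.mono_set Set.Ioc_subset_Ioi_self), ← integral_neg]
    refine setIntegral_congr_fun measurableSet_Ioc fun t ht => ?_
    have : t ≠ 0 := by have := ht.1; linarith
    simp only [he]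
    field_simp
    ring
  have h3 : ∫ t in Set.Ioi 1, e t / t ^ 2 =
      (∫ t in Set.Ioc 1 y, e t / t ^ 2) + ∫ t in Set.Ioi y, e t / t ^ 2 := by
    rw [← setIntegral_union (Set.Ioc_disjoint_Ioi le_rfl) measurableSet_Ioi
      (hI.mono_set Set.Ioc_subset_Ioi_self) (hI.mono_set (Set.Ioi_subset_Ioi hy)),
      Set.Ioc_union_Ioi_eq_Ioi hy]
  have h4 := abs_integral_Ioi_div_sq_le (e := e) h hy0
  have h5 : |e y / y| ≤ c / √y := by
    rw [abs_div, abs_of_pos hy0, div_le_div_iff₀ hy0 (Real.sqrt_pos.2 hy0)]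
    have := mul_le_mul_of_nonneg_right (h y hy0.le) (Real.sqrt_nonneg y)
    rwa [mul_assoc, Real.mul_self_sqrt hy0.le] at this
  have h6 : psum (r.pmul recip) y - L * Real.log y - (L + ∫ t in Set.Ioi 1, e t / t ^ 2) =
      e y / y - ∫ t in Set.Ioi y, e t / t ^ 2 := by
    rw [h1, h2, h3]
    simp only [he]
    field_simp
    ring
  rw [h6]
  refine (abs_sub _ _).trans ((add_le_add h5 h4).trans_eq ?_)
  ring

lemma abs_psum_log_sub_le (h : ∀ t, 0 ≤ t → |psum r t - L * t| ≤ c * √t) (hc : 0 ≤ c) {y : ℝ}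
    (hy : 1 ≤ y) :
    |psum (r.pmul log) y - (psum r y * Real.log y - L * y)| ≤ 2 * c * √y + |L| := by
  set e : ℝ → ℝ := fun t => psum r t - L * t with he
  have hem : Measurable e := measurable_psum_sub r L
  have hy0 : 0 < y := one_pos.trans_le hy
  have h1 := psum_pmul_eq r log (g := Real.log) (g' := fun t => t⁻¹) (fun n => rfl)
    (fun t ht => Real.hasDerivAt_log (by linarith)) (by
      refine ContinuousOn.inv₀ continuousOn_id fun t ht => ?_
      have : (1 : ℝ) ≤ t := ht
      simp; linarith) y
  have hint : IntegrableOn (fun t => e t / t) (Set.Ioc 1 y) := by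
    refine integrableOn_Ioc_of_abs_le (c := c) (hem.div measurable_id) fun t ht => ?_
    have ht1 := ht.1
    have ht0 : 0 < t := by linarith
    rw [abs_div, abs_of_pos ht0, div_le_iff₀ ht0]
    refine (h t ht0.le).trans (mul_le_mul_of_nonneg_left ?_ hc)
    rw [Real.sqrt_le_left ht0.le]
    nlinarith
  have h2 : ∫ t in Set.Ioc 1 y, t⁻¹ * psum r t =
      L * (y - 1) + ∫ t in Set.Ioc 1 y, e t / t := by
    rw [show L * (y - 1) = ∫ t in Set.Ioc 1 y, L by
        rw [← intervalIntegral.integral_of_le hy, intervalIntegral.integral_const, smul_eq_mul]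
        ring,
      ← integral_add (by simp) hint]
    refine setIntegral_congr_fun measurableSet_Ioc fun t ht => ?_
    have : t ≠ 0 := by have := ht.1; linarith
    simp only [he]
    field_simp
    ring
  have h4 := abs_integral_Ioc_div_le (e := e) h hc hy
  have h6 : psum (r.pmul log) y - (psum r y * Real.log y - L * y) =
      L - ∫ t in Set.Ioc 1 y, e t / t := by
    rw [h1, h2]; ring
  rw [h6]
  refine (abs_sub _ _).trans ?_
  linarith
end

/-! ### The Selberg-type identity -/

lemma psum_mul_le {a b : ArithmeticFunction ℝ} (ha : ∀ n, 0 ≤ a n) (hb : ∀ n, 0 ≤ b n) {x : ℝ}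
    (hx : 0 ≤ x) : psum (a * b) x ≤ psum a x * psum b x := by
  rw [psum_mul, psum, sum_mul]
  refine sum_le_sum fun n hn => mul_le_mul_of_nonneg_left (psum_mono_right hb ?_) (ha n)
  exact div_le_self hx (by exact_mod_cast (mem_Ioc.1 hn).1)

lemma one_le_div_of_mem {x : ℝ} {n : ℕ} (hn : n ∈ Ioc 0 ⌊x⌋₊) : 1 ≤ x / n ∧ (0 : ℝ) < n := by
  obtain ⟨h1, h2⟩ := mem_Ioc.1 hn
  have h3 : (0 : ℝ) < n := by exact_mod_cast h1
  exact ⟨(one_le_div h3).2 ((Nat.le_floor_iff' h1.ne').1 h2), h3⟩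

section
variable {χ : ArithmeticFunction ℝ} {p₀ : ℕ}

lemma splitMoebius_mul_zeta_mul (hχ : IsQuadChar χ p₀) :
    splitMoebius χ * ((ζ : ArithmeticFunction ℝ) * χ) = normInd χ := by
  rw [← splitInd_mul_normInd hχ, ← mul_assoc, mul_comm (splitMoebius χ), splitInd_mul_splitMoebius,
    one_mul]

/-- The kernel whose convolution with the twisted Möbius function gives the identity for
`∑ f(n) log n`. -/
noncomputable def selbergKernel (χ : ArithmeticFunction ℝ) (κ y : ℝ) : ℝ :=
  psum (((ζ : ArithmeticFunction ℝ) * χ).pmul log) y -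
    y * psum (((ζ : ArithmeticFunction ℝ) * χ).pmul recip) y +
    κ * psum ((ζ : ArithmeticFunction ℝ) * χ) y

/-- Each piece of the kernel is a sum of r with some weight, and μg * r = f. The factor y = x/n in
the middle piece becomes x times the weight 1/n on μg. -/
lemma selberg_identity (hχ : IsQuadChar χ p₀) (κ x : ℝ) :
    ∑ n ∈ Ioc 0 ⌊x⌋₊, splitMoebius χ n * selbergKernel χ κ (x / n) =
      2 * psum ((normInd χ).pmul log) x - psum (nonsplitLog χ) x -
        x * psum ((normInd χ).pmul recip) x + κ * psum (normInd χ) x := by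
  have h1 : psum (splitMoebius χ * ((ζ : ArithmeticFunction ℝ) * χ).pmul log) x =
      2 * psum ((normInd χ).pmul log) x - psum (nonsplitLog χ) x := by
    rw [← splitInd_mul_normInd hχ, splitMoebius_mul_pmul_log, eq_sub_iff_add_eq, ← psum_add,
      sub_add_cancel, psum_add]
    ring
  have h2 : psum (((ζ : ArithmeticFunction ℝ) * χ).pmul recip * (splitMoebius χ).pmul recip) x =
      psum ((normInd χ).pmul recip) x := by
    rw [← pmul_recip_mul, mul_comm, splitMoebius_mul_zeta_mul hχ]
  have h3 := congrArg (fun a => psum a x) (splitMoebius_mul_zeta_mul hχ)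
  rw [← h1, ← h2, ← h3, mul_comm (pmul _ _), psum_mul (splitMoebius χ),
    psum_mul ((splitMoebius χ).pmul recip), psum_mul (splitMoebius χ)]
  rw [mul_sum, mul_sum, ← sum_sub_distrib, ← sum_add_distrib]
  refine sum_congr rfl fun n _ => ?_
  rw [selbergKernel, pmul_apply, recip_apply]
  ring

lemma exists_abs_selbergKernel_le (hχ : IsQuadChar χ p₀) (hL : 0.59 ≤ valL χ) (hL1 : valL χ ≤ 1) :
    ∃ κ, |κ| ≤ 9 ∧ ∀ y, 1 ≤ y → |selbergKernel χ κ y| ≤ √y * (2 * Real.log y + 29) := by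
  set L := valL χ with hLdef
  have hL0 : 0 < L := by linarith
  have hR : ∀ t, 0 ≤ t → |psum ((ζ : ArithmeticFunction ℝ) * χ) t - L * t| ≤ 2 * √t :=
    fun t ht => abs_psum_zeta_mul_sub_le hχ ht
  obtain ⟨C, hC, hT⟩ := exists_psum_recip_approx hR
  have hκ : |1 + C / L| ≤ 9 := by
    rw [abs_le] at hC
    rw [abs_le, ← sub_le_iff_le_add', ← le_sub_iff_add_le', le_div_iff₀ hL0, div_le_iff₀ hL0]
    constructor <;> linarith
  -- The y log y terms cancel by themselves; this κ also cancels the linear term -(L + C) y. The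
  -- bound 9 comes from |C - L| ≤ 4 and L ≥ 0.59.
  refine ⟨1 + C / L, hκ, fun y hy => ?_⟩
  have hy0 : 0 < y := by linarith
  have hs : 1 ≤ √y := Real.one_le_sqrt.2 hy
  have hlog := Real.log_nonneg hy
  have h1 := abs_psum_log_sub_le hR zero_le_two hy
  have h2 := hT y hy
  have h3 := hR y hy0.le
  rw [abs_of_pos hL0] at h1
  set R := psum ((ζ : ArithmeticFunction ℝ) * χ) y
  set κ := 1 + C / L with hκdef
  have hκL : κ * L = L + C := by rw [hκdef]; field_simp
  have e : selbergKernel χ κ y =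
      (psum (((ζ : ArithmeticFunction ℝ) * χ).pmul log) y - (R * Real.log y - L * y)) +
      (R - L * y) * Real.log y -
      y * (psum (((ζ : ArithmeticFunction ℝ) * χ).pmul recip) y - L * Real.log y - C) +
      κ * (R - L * y) := by
    rw [selbergKernel]
    linear_combination y * hκL
  have k1 : |(R - L * y) * Real.log y| ≤ 2 * √y * Real.log y := by
    rw [abs_mul, abs_of_nonneg hlog]
    exact mul_le_mul_of_nonneg_right h3 hlog
  have k2 : |y * (psum (((ζ : ArithmeticFunction ℝ) * χ).pmul recip) y - L * Real.log y - C)| ≤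
      6 * √y := by
    rw [abs_mul, abs_of_pos hy0]
    refine (mul_le_mul_of_nonneg_left h2 hy0.le).trans_eq ?_
    have : y = √y * √y := (Real.mul_self_sqrt hy0.le).symm
    field_simp
    rw [sq, ← this]
    ring
  have k3 : |κ * (R - L * y)| ≤ 18 * √y := by
    rw [abs_mul]
    have := mul_le_mul hκ h3 (abs_nonneg _) (by norm_num)
    linarith
  rw [e]
  refine (abs_add_le _ _).trans ?_
  have k4 := abs_sub (psum (((ζ : ArithmeticFunction ℝ) * χ).pmul log) y - (R * Real.log y - L * y) +
      (R - L * y) * Real.log y)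
      (y * (psum (((ζ : ArithmeticFunction ℝ) * χ).pmul recip) y - L * Real.log y - C))
  have k5 := abs_add_le (psum (((ζ : ArithmeticFunction ℝ) * χ).pmul log) y -
    (R * Real.log y - L * y)) ((R - L * y) * Real.log y)
  nlinarith

/-- The weight that dominates the error of the Selberg-type identity. -/
noncomputable def errWeight (y : ℝ) : ℝ := √y * (2 * Real.log y + 55)

lemma abs_two_log_mul_psum_sub_le (hχ : IsQuadChar χ p₀) (hp : p₀ ≤ 3) (hL : 0.59 ≤ valL χ)
    (hL1 : valL χ ≤ 1) {x : ℝ} (hx : 0 < x) :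
    |2 * Real.log x * psum (normInd χ) x - x * psum ((normInd χ).pmul recip) x| ≤
      ∑ n ∈ Ioc 0 ⌊x⌋₊, normInd χ n * errWeight (x / n) := by
  obtain ⟨κ, hκ, hW⟩ := exists_abs_selbergKernel_le hχ hL hL1
  have hid := selberg_identity hχ κ x
  have hJ := psum_nonsplitLog_le hχ x
  have hJ0 := psum_nonneg (nonsplitLog_nonneg χ) x
  have hlogsum : psum ((normInd χ).pmul log) x = Real.log x * psum (normInd χ) x -
      ∑ n ∈ Ioc 0 ⌊x⌋₊, normInd χ n * Real.log (x / n) := by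
    rw [psum, psum, mul_sum, ← sum_sub_distrib]
    refine sum_congr rfl fun n hn => ?_
    have := (one_le_div_of_mem hn).2
    rw [pmul_apply, log_apply, Real.log_div hx.ne' this.ne']
    ring
  have hS : |∑ n ∈ Ioc 0 ⌊x⌋₊, splitMoebius χ n * selbergKernel χ κ (x / n)| ≤
      ∑ n ∈ Ioc 0 ⌊x⌋₊, normInd χ n * (√(x / n) * (2 * Real.log (x / n) + 29)) := by
    refine (abs_sum_le_sum_abs _ _).trans (sum_le_sum fun n hn => ?_)
    rw [abs_mul]
    exact mul_le_mul (abs_splitMoebius_le χ n) (hW _ (one_le_div_of_mem hn).1) (abs_nonneg _)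
      (normInd_nonneg χ n)
  have hB0 := psum_nonneg (normInd_nonneg χ) x
  have hκB : |κ * psum (normInd χ) x| ≤ 9 * psum (normInd χ) x := by
    rw [abs_mul, abs_of_nonneg hB0]
    exact mul_le_mul_of_nonneg_right hκ hB0
  have hlog0 : 0 ≤ ∑ n ∈ Ioc 0 ⌊x⌋₊, normInd χ n * Real.log (x / n) :=
    sum_nonneg fun n hn => mul_nonneg (normInd_nonneg χ n)
      (Real.log_nonneg (one_le_div_of_mem hn).1)
  have hfin : (∑ n ∈ Ioc 0 ⌊x⌋₊, normInd χ n * (√(x / n) * (2 * Real.log (x / n) + 29))) +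
      (∑ n ∈ Ioc 0 ⌊x⌋₊, normInd χ n * (Real.log p₀ + 2 * Chebyshev.psi √(x / n))) +
      9 * psum (normInd χ) x + 2 * ∑ n ∈ Ioc 0 ⌊x⌋₊, normInd χ n * Real.log (x / n) ≤
      ∑ n ∈ Ioc 0 ⌊x⌋₊, normInd χ n * errWeight (x / n) := by
    rw [psum, mul_sum, mul_sum, ← sum_add_distrib, ← sum_add_distrib, ← sum_add_distrib]
    refine sum_le_sum fun n hn => ?_
    obtain ⟨hy, -⟩ := one_le_div_of_mem hn
    set y := x / n
    have hs : 1 ≤ √y := Real.one_le_sqrt.2 hy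
    have h1 : Real.log p₀ ≤ 2 := by
      have hp0 : (0 : ℝ) < p₀ := by exact_mod_cast hχ.prime.pos
      have hp3 : (p₀ : ℝ) ≤ 3 := by exact_mod_cast hp
      linarith [Real.log_le_sub_one_of_pos hp0]
    have h2 := Chebyshev.psi_le_const_mul_self (x := √y) (Real.sqrt_nonneg y)
    have h3 : Real.log 4 ≤ 1.4 := by
      rw [show (4 : ℝ) = 2 ^ 2 by norm_num, Real.log_pow]
      have := Real.log_two_lt_d9
      push_cast
      linarith
    have h3' := mul_le_mul_of_nonneg_right h3 (Real.sqrt_nonneg y)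
    have h4 : Real.log y ≤ 2 * √y := by
      have := Real.log_le_sub_one_of_pos (x := √y) (by linarith)
      rw [Real.log_sqrt (by linarith)] at this
      linarith
    -- The constant 55 is 29 from the kernel, 2 from log p₀, 9 from κ, 4 from 2 log y ≤ 4√y, and 11
    -- for the term 2ψ(√y).
    have h5 : √y * (2 * Real.log y + 29) + (Real.log p₀ + 2 * Chebyshev.psi √y) + 9 +
        2 * Real.log y ≤ errWeight y := by
      rw [errWeight]; nlinarith
    have := mul_le_mul_of_nonneg_left h5 (normInd_nonneg χ n)
    linarith
  rw [abs_le] at *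
  constructor <;> linarith [hS.1, hS.2, hκB.1, hκB.2]

/-! ### Bounding the error and bootstrapping -/

lemma sum_inv_sqrt_le (N : ℕ) : ∑ n ∈ Ioc 0 N, (√(n : ℝ))⁻¹ ≤ 2 * √(N : ℝ) := by
  induction N with
  | zero => simp
  | succ N ih =>
    rw [sum_Ioc_succ_top (Nat.zero_le N)]
    set a := √((N + 1 : ℕ) : ℝ) with ha
    set b := √(N : ℝ) with hb
    have ha2 : a * a = N + 1 := by rw [ha, Real.mul_self_sqrt (by positivity)]; push_cast; ring
    have hb2 : b * b = N := Real.mul_self_sqrt (by positivity)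
    have ha0 : 0 < a := Real.sqrt_pos.2 (by positivity)
    have : a⁻¹ ≤ 2 * (a - b) := by
      rw [inv_le_iff_one_le_mul₀ ha0]
      nlinarith [sq_nonneg (a - b)]
    linarith

lemma sum_inv_sqrt_mul_sqrt_sqrt_le (N : ℕ) :
    ∑ n ∈ Ioc 0 N, (√(n : ℝ) * √√(n : ℝ))⁻¹ ≤ 4 * √√(N : ℝ) := by
  induction N with
  | zero => simp
  | succ N ih =>
    rw [sum_Ioc_succ_top (Nat.zero_le N)]
    set a := √√((N + 1 : ℕ) : ℝ) with ha
    set b := √√(N : ℝ) with hb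
    have ha2 : a ^ 2 = √((N + 1 : ℕ) : ℝ) := Real.sq_sqrt (by positivity)
    have hb2 : b ^ 2 = √(N : ℝ) := Real.sq_sqrt (by positivity)
    have ha4 : a ^ 4 = N + 1 := by
      rw [show a ^ 4 = (a ^ 2) ^ 2 by ring, ha2, Real.sq_sqrt (by positivity)]; push_cast; ring
    have hb4 : b ^ 4 = N := by
      rw [show b ^ 4 = (b ^ 2) ^ 2 by ring, hb2, Real.sq_sqrt (by positivity)]
    have ha0 : 0 < a := Real.sqrt_pos.2 (Real.sqrt_pos.2 (by positivity))
    have hb0 : 0 ≤ b := Real.sqrt_nonneg _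
    have hab : b ≤ a := Real.sqrt_le_sqrt (Real.sqrt_le_sqrt (by push_cast; linarith))
    have : (√((N + 1 : ℕ) : ℝ) * a)⁻¹ ≤ 4 * (a - b) := by
      rw [← ha2, inv_le_iff_one_le_mul₀ (by positivity)]
      have e : 1 = (a - b) * (a ^ 3 + a ^ 2 * b + a * b ^ 2 + b ^ 3) := by
        linear_combination hb4 - ha4
      have h1 : a ^ 2 * b ≤ a ^ 3 := by nlinarith [sq_nonneg a]
      have h2 : a * b ^ 2 ≤ a ^ 3 := by nlinarith [mul_nonneg ha0.le hb0]
      have h3 : b ^ 3 ≤ a ^ 3 := pow_le_pow_left₀ hb0 hab 3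
      rw [e]
      have := mul_le_mul_of_nonneg_left (add_le_add (add_le_add h1 h2) h3) (sub_nonneg.2 hab)
      nlinarith
    linarith

/-- Uses log y ≤ 4 (y^(1/4) - 1). The resulting powers y^(3/4) and y^(1/2) sum over n to O(x), with
total constant 8·4 + 47·2 = 126. -/
lemma errWeight_le {y : ℝ} (hy : 1 ≤ y) : errWeight y ≤ 8 * (√y * √√y) + 47 * √y := by
  have hs : 1 ≤ √y := Real.one_le_sqrt.2 hy
  have h := Real.log_le_sub_one_of_pos (x := √√y) (Real.sqrt_pos.2 (by linarith))
  rw [Real.log_sqrt (by linarith), Real.log_sqrt (by linarith)] at h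
  rw [errWeight]
  nlinarith

lemma sum_errWeight_le {x : ℝ} (hx : 0 < x) : ∑ n ∈ Ioc 0 ⌊x⌋₊, errWeight (x / n) ≤ 126 * x := by
  have hfl : ((⌊x⌋₊ : ℕ) : ℝ) ≤ x := Nat.floor_le hx.le
  calc ∑ n ∈ Ioc 0 ⌊x⌋₊, errWeight (x / n)
      ≤ ∑ n ∈ Ioc 0 ⌊x⌋₊, (8 * (√x * √√x) * (√(n : ℝ) * √√(n : ℝ))⁻¹ + 47 * √x * (√(n : ℝ))⁻¹) := by
        refine sum_le_sum fun n hn => (errWeight_le (one_le_div_of_mem hn).1).trans_eq ?_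
        rw [Real.sqrt_div hx.le, Real.sqrt_div (Real.sqrt_nonneg x), mul_inv]
        ring
    _ ≤ 8 * (√x * √√x) * (4 * √√x) + 47 * √x * (2 * √x) := by
        rw [sum_add_distrib, ← mul_sum, ← mul_sum]
        refine add_le_add (mul_le_mul_of_nonneg_left
          ((sum_inv_sqrt_mul_sqrt_sqrt_le _).trans ?_) (by positivity))
          (mul_le_mul_of_nonneg_left ((sum_inv_sqrt_le _).trans ?_) (by positivity))
        · gcongr
        · gcongr
    _ = 126 * x := by
        have h1 := Real.mul_self_sqrt hx.le
        have h2 := Real.mul_self_sqrt (Real.sqrt_nonneg x)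
        linear_combination 32 * √x * h2 + 126 * h1

lemma errWeight_nonneg {y : ℝ} (hy : 1 ≤ y) : 0 ≤ errWeight y := by
  have := Real.log_nonneg hy
  exact mul_nonneg (Real.sqrt_nonneg y) (by linarith)

lemma errWeight_mono {y z : ℝ} (hy : 1 ≤ y) (hyz : y ≤ z) : errWeight y ≤ errWeight z := by
  have h1 := Real.log_nonneg hy
  have h2 := Real.log_le_log (by linarith) hyz
  exact mul_le_mul (Real.sqrt_le_sqrt hyz) (by linarith) (by linarith) (Real.sqrt_nonneg z)

lemma two_log_mul_psum_le (hχ : IsQuadChar χ p₀) (hp : p₀ ≤ 3) (hL : 0.59 ≤ valL χ)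
    (hL1 : valL χ ≤ 1) {x : ℝ} (hx : 0 < x) :
    2 * Real.log x * psum (normInd χ) x ≤ x * (psum ((normInd χ).pmul recip) x + 126) := by
  have h1 := (abs_le.1 (abs_two_log_mul_psum_sub_le hχ hp hL hL1 hx)).2
  have h2 : ∑ n ∈ Ioc 0 ⌊x⌋₊, normInd χ n * errWeight (x / n) ≤
      ∑ n ∈ Ioc 0 ⌊x⌋₊, errWeight (x / n) :=
    sum_le_sum fun n hn => mul_le_of_le_one_left (errWeight_nonneg (one_le_div_of_mem hn).1)
      (normInd_le_one χ n)
  have h3 := sum_errWeight_le hx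
  linarith

/-- Partial summation: a linear bound for the summatory function of `f` transfers to sums weighted
by a decreasing function. -/
lemma sum_mul_le_of_sum_le {f v : ℕ → ℝ} {ρ τ : ℝ} {N : ℕ} (hN : 1 ≤ N)
    (hf : ∀ k, 1 ≤ k → k ≤ N → ∑ n ∈ Ioc 0 k, f n ≤ ρ * k + τ)
    (hv : ∀ n, 1 ≤ n → n + 1 ≤ N → v (n + 1) ≤ v n) (hv0 : 0 ≤ v N) :
    ∑ n ∈ Ioc 0 N, f n * v n ≤ ρ * ∑ n ∈ Ioc 0 N, v n + τ * v 1 := by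
  have key : ∀ k, 1 ≤ k → k ≤ N → ∑ n ∈ Ioc 0 k, f n * v n ≤ ρ * ∑ n ∈ Ioc 0 k, v n + τ * v 1 +
      (∑ n ∈ Ioc 0 k, f n - ρ * k - τ) * v k := by
    intro k hk
    induction k, hk using Nat.le_induction with
    | base => intro _; simp; linarith
    | succ k hk ih =>
      intro hkN
      have h1 := ih (by lia)
      have h2 := hf k hk (by lia)
      have h3 := hv k hk hkN
      rw [sum_Ioc_succ_top (Nat.zero_le k), sum_Ioc_succ_top (Nat.zero_le k),
        sum_Ioc_succ_top (Nat.zero_le k)]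
      push_cast
      nlinarith
  have h1 := key N hN le_rfl
  have h2 := hf N hN le_rfl
  nlinarith

/-- Since g ≤ f, the function r = g * f is at most f * f, and the hyperbolic region of a convolution
sum lies inside the full square. -/
lemma sq_psum_recip_ge (hχ : IsQuadChar χ p₀) {x : ℝ} (hx : 0 ≤ x) :
    psum (((ζ : ArithmeticFunction ℝ) * χ).pmul recip) x ≤ psum ((normInd χ).pmul recip) x ^ 2 := by
  have h0 : ∀ n, 0 ≤ (normInd χ).pmul recip n := fun n =>
    mul_nonneg (normInd_nonneg χ n) (by simp)
  rw [← splitInd_mul_normInd hχ, pmul_recip_mul, sq]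
  refine (psum_mul_le (fun n => mul_nonneg (splitInd_nonneg χ n) (by simp)) h0 hx).trans ?_
  refine mul_le_mul_of_nonneg_right (psum_mono (fun n => ?_) x) (psum_nonneg h0 x)
  exact mul_le_mul_of_nonneg_right (splitInd_le_normInd χ n) (by simp)

lemma psum_recip_ge (hχ : IsQuadChar χ p₀) (hL : 0.59 ≤ valL χ) {x : ℝ} (hx1 : 1 ≤ x)
    (hx : 20000 ≤ Real.log x) : 108 ≤ psum ((normInd χ).pmul recip) x := by
  obtain ⟨C, hC, hT⟩ := exists_psum_recip_approx
    (fun t ht => abs_psum_zeta_mul_sub_le hχ (y := t) ht)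
  have h1 := (abs_le.1 (hT x hx1)).1
  have h2 := (abs_le.1 hC).1
  have hs : 1 ≤ √x := Real.one_le_sqrt.2 hx1
  have h3 : 3 * 2 / √x ≤ 6 := by rw [div_le_iff₀ (by linarith)]; linarith
  have h4 := sq_psum_recip_ge hχ (by linarith : 0 ≤ x)
  have h5 : 0 ≤ psum ((normInd χ).pmul recip) x :=
    psum_nonneg (fun n => mul_nonneg (normInd_nonneg χ n) (by simp)) x
  -- 0.59 · 20000 - 10 exceeds 108².
  by_contra! h6
  nlinarith

/-- `B(x) = x M(x) / (2 log x) (1 + O(1 / log x))` where `M(x) = ∑ f(n) / n`. -/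
theorem abs_two_log_mul_psum_sub_le_div_log (hχ : IsQuadChar χ p₀) (hp : p₀ ≤ 3)
    (hL : 0.59 ≤ valL χ) (hL1 : valL χ ≤ 1) {x : ℝ} (hx1 : 1 ≤ x) (hx : 20000 ≤ Real.log x) :
    |2 * Real.log x * psum (normInd χ) x - x * psum ((normInd χ).pmul recip) x| ≤
      345 / Real.log x * (x * psum ((normInd χ).pmul recip) x) := by
  have hx0 : 0 < x := by linarith
  have hM := psum_recip_ge hχ hL hx1 hx
  set M := psum ((normInd χ).pmul recip) x with hMdef
  set t := Real.log x with ht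
  have ht0 : 0 < t := by linarith
  have hrn : ∀ n, 0 ≤ (normInd χ).pmul recip n := fun n =>
    mul_nonneg (normInd_nonneg χ n) (by simp)
  refine (abs_two_log_mul_psum_sub_le hχ hp hL hL1 hx0).trans ?_
  have hN1 : 1 ≤ ⌊x⌋₊ := (Nat.one_le_floor_iff _).2 hx1
  -- Here τ = x^(2/5). Below τ the count is bounded trivially by τ; above it log k ≥ (2/5) log x, so
  -- the first bound for B gives density ρ, with 5/4 = 1/(2 · 2/5).
  set τ := Real.exp (2 / 5 * t) with hτ
  set ρ := (M + 126) * (5 / 4) / t with hρ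
  have hρ0 : 0 ≤ ρ := by positivity
  have hpart : ∑ n ∈ Ioc 0 ⌊x⌋₊, normInd χ n * errWeight (x / n) ≤
      ρ * ∑ n ∈ Ioc 0 ⌊x⌋₊, errWeight (x / n) + τ * errWeight (x / (1 : ℕ)) := by
    refine sum_mul_le_of_sum_le (f := fun n => normInd χ n) (v := fun n => errWeight (x / n)) hN1
      (fun k hk hkN => ?_) (fun n hn hnN => ?_) ?_
    · have hk0 : (0 : ℝ) < k := by exact_mod_cast hk
      have hkx : (k : ℝ) ≤ x := (Nat.le_floor_iff' (by lia)).1 hkN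
      rcases le_total (k : ℝ) τ with hkτ | hkτ
      · have : ∑ n ∈ Ioc 0 k, normInd χ n ≤ k :=
          (sum_le_sum fun n _ => normInd_le_one χ n).trans_eq (by simp)
        have : 0 ≤ ρ * k := by positivity
        linarith
      · have h1 := two_log_mul_psum_le hχ hp hL hL1 hk0
        have h2 : 2 / 5 * t ≤ Real.log k := by
          rw [← Real.log_exp (2 / 5 * t)]
          exact Real.log_le_log (Real.exp_pos _) hkτ
        have h3 : psum ((normInd χ).pmul recip) k ≤ M := psum_mono_right hrn hkx
        have h4 : psum (normInd χ) k = ∑ n ∈ Ioc 0 k, normInd χ n := by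
          rw [psum, Nat.floor_natCast]
        rw [h4] at h1
        set S := ∑ n ∈ Ioc 0 k, normInd χ n with hS
        have hS0 : 0 ≤ S := sum_nonneg fun n _ => normInd_nonneg χ n
        have h5 : 2 * (2 / 5 * t) * S ≤ k * (M + 126) := by
          calc 2 * (2 / 5 * t) * S ≤ 2 * Real.log k * S := by gcongr
            _ ≤ _ := h1
            _ ≤ k * (M + 126) := by gcongr
        have h6 : S ≤ ρ * k := by
          rw [hρ, div_mul_eq_mul_div, le_div_iff₀ ht0]
          linarith
        have : 0 ≤ τ := (Real.exp_pos _).le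
        linarith
    · refine errWeight_mono ?_ ?_
      · exact (one_le_div_of_mem (mem_Ioc.2 ⟨by lia, hnN⟩)).1
      · have : (0 : ℝ) < n := by exact_mod_cast hn
        gcongr
        lia
    · exact errWeight_nonneg (one_le_div_of_mem (mem_Ioc.2 ⟨hN1, le_rfl⟩)).1
  rw [Nat.cast_one, div_one] at hpart
  refine hpart.trans ?_
  have h1 := mul_le_mul_of_nonneg_left (sum_errWeight_le hx0) hρ0
  have hxexp : x = Real.exp t := (Real.exp_log hx0).symm
  have hsq : √x = Real.exp (t / 2) := by
    rw [hxexp, Real.exp_half]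
  -- The left side is x^(9/10) (2 log x + 55), and the spare x^(1/10) absorbs both logarithmic
  -- factors.
  have h2 : τ * errWeight x ≤ x / t := by
    have e1 : τ * errWeight x = Real.exp (9 / 10 * t) * (2 * t + 55) := by
      rw [errWeight, ← ht, hsq, hτ, ← mul_assoc, ← Real.exp_add]
      congr 2; ring
    have e2 : x = Real.exp (9 / 10 * t) * Real.exp (t / 10) := by
      rw [← Real.exp_add, hxexp]; congr 1
      ring
    rw [e1, e2, mul_div_assoc]
    refine mul_le_mul_of_nonneg_left ?_ (Real.exp_pos _).le
    rw [le_div_iff₀ ht0]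
    have h3 := Real.pow_div_factorial_le_exp (t / 10) (by positivity) 3
    norm_num [Nat.factorial] at h3
    refine le_trans ?_ h3
    nlinarith [mul_nonneg ht0.le ht0.le]
  refine (add_le_add h1 h2).trans ?_
  rw [hρ, ← sub_nonneg]
  -- The constant 345 is large enough because M ≥ 108.
  have e : 345 / t * (x * M) - ((M + 126) * (5 / 4) / t * (126 * x) + x / t) =
      x / t * (345 * M - (M + 126) * (5 / 4) * 126 - 1) := by
    ring
  rw [e]
  have : 0 ≤ x / t := by positivity
  exact mul_nonneg this (by linarith)
end

/-! ### Differential inequality for the logarithmic mean -/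

lemma le_of_le_on_unit_intervals {φ : ℝ → ℝ} {a : ℝ} (ha : 0 ≤ a)
    (h : ∀ (k : ℕ) (u v : ℝ), a ≤ u → k ≤ u → u ≤ v → v ≤ k + 1 → φ v ≤ φ u) {u v : ℝ}
    (hu : a ≤ u) (huv : u ≤ v) : φ v ≤ φ u := by
  have hk : ((⌊u⌋₊ : ℕ) : ℝ) ≤ u := Nat.floor_le (ha.trans hu)
  have hk1 : u < (⌊u⌋₊ : ℕ) + 1 := Nat.lt_floor_add_one u
  have key : ∀ (n : ℕ) (w : ℝ), u ≤ w → w ≤ (⌊u⌋₊ : ℕ) + 1 + n → φ w ≤ φ u := by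
    intro n
    induction n with
    | zero => intro w h1 h2; exact h _ u w hu hk h1 (by simpa using h2)
    | succ n ih =>
      intro w h1 h2
      rcases le_total w ((⌊u⌋₊ : ℕ) + 1 + n) with h3 | h3
      · exact ih w h1 h3
      · have h4 : u ≤ ((⌊u⌋₊ + 1 + n : ℕ) : ℝ) := by
          push_cast
          have : (0 : ℝ) ≤ n := n.cast_nonneg
          linarith
        refine (h (⌊u⌋₊ + 1 + n) _ w (hu.trans h4) le_rfl (by push_cast; exact h3)
          (by push_cast at h2 ⊢; linarith)).trans (ih _ h4 (by push_cast; exact le_rfl))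
  obtain ⟨n, hn⟩ := exists_nat_ge v
  exact key n v huv (by linarith [(Nat.cast_nonneg ⌊u⌋₊ : (0 : ℝ) ≤ _)])

/-- The average `∫₁ˣ B(t) / t ^ 2 dt` in closed form. -/
noncomputable def logMean (f : ArithmeticFunction ℝ) (u : ℝ) : ℝ :=
  psum (f.pmul recip) u - psum f u / u

/-- At u = k + 1 the jumps f(k+1)/(k+1) of the two terms cancel, so one smooth formula holds on the
closed interval, and monotonicity can be glued across integers. -/
lemma logMean_eq (f : ArithmeticFunction ℝ) {k : ℕ} {u : ℝ} (hk : (k : ℝ) ≤ u) (hu : u ≤ k + 1) :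
    logMean f u = psum (f.pmul recip) k - psum f k / u := by
  rcases hu.lt_or_eq with h | h
  · have : ⌊u⌋₊ = k := Nat.floor_eq_iff (k.cast_nonneg.trans hk) |>.2 ⟨hk, h⟩
    simp only [logMean, psum, this, Nat.floor_natCast]
  · subst h
    have : ⌊(k : ℝ) + 1⌋₊ = k + 1 := by exact_mod_cast Nat.floor_natCast (k + 1)
    have hk0 : (k : ℝ) + 1 ≠ 0 := by positivity
    simp only [logMean, psum, this, Nat.floor_natCast, sum_Ioc_succ_top (Nat.zero_le k),
      pmul_apply, recip_apply]
    push_cast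
    field_simp
    ring

section
variable {f : ArithmeticFunction ℝ} {a : ℝ}

lemma psum_div_bounds (hlog : 20000 ≤ Real.log a)
    (ha : 1 ≤ a) (hM : ∀ u, a ≤ u → 0 < psum (f.pmul recip) u)
    (hf : ∀ u, a ≤ u → |2 * Real.log u * psum f u - u * psum (f.pmul recip) u| ≤
      345 / Real.log u * (u * psum (f.pmul recip) u)) {u : ℝ} (hu : a ≤ u) :
    20000 ≤ Real.log u ∧
    (psum f u / u) * (2 * Real.log u ^ 2) ≤ (Real.log u + 345) * psum (f.pmul recip) u ∧
    (Real.log u - 345) * psum (f.pmul recip) u ≤ (psum f u / u) * (2 * Real.log u ^ 2) ∧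
    0 < logMean f u := by
  have hu0 : 0 < u := by linarith
  have hl : 20000 ≤ Real.log u := hlog.trans (Real.log_le_log (by linarith) hu)
  have hMu := hM u hu
  have h := hf u hu
  unfold logMean
  set l := Real.log u
  set M := psum (f.pmul recip) u
  obtain ⟨β, hβ⟩ : ∃ β, β = psum f u / u := ⟨_, rfl⟩
  have hβ' : psum f u = u * β := by rw [hβ]; field_simp
  rw [hβ', abs_le] at h
  rw [← hβ]
  have hl0 : 0 < l := by linarith
  have e1 : 345 / l * (u * M) * l = 345 * (u * M) := by field_simp
  have h1 := mul_le_mul_of_nonneg_right h.1 hl0.le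
  have h2 := mul_le_mul_of_nonneg_right h.2 hl0.le
  rw [neg_mul, e1] at h1
  rw [e1] at h2
  have k1 : β * (2 * l ^ 2) ≤ (l + 345) * M := by
    refine le_of_mul_le_mul_left ?_ hu0
    linarith
  have k2 : (l - 345) * M ≤ β * (2 * l ^ 2) := by
    refine le_of_mul_le_mul_left ?_ hu0
    linarith
  refine ⟨hl, k1, k2, ?_⟩
  by_contra! h3
  have h4 : M * (2 * l ^ 2) ≤ (l + 345) * M :=
    (mul_le_mul_of_nonneg_right (by linarith : M ≤ β) (by positivity)).trans k1
  nlinarith [mul_pos hMu hl0]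

/-- The logarithm of `logMean f u / √(log u)` with a correction term. -/
noncomputable def corrLogMean (f : ArithmeticFunction ℝ) (c u : ℝ) : ℝ :=
  Real.log (logMean f u) - 1 / 2 * Real.log (Real.log u) + c / Real.log u

lemma hasDerivAt_corrLogMean_aux {M B c t : ℝ} (ht : 0 < t) (hl : 0 < Real.log t)
    (hP : 0 < M - B / t) :
    HasDerivAt (fun u => Real.log (M - B / u) - 1 / 2 * Real.log (Real.log u) + c / Real.log u)
      (1 / t * (B / t / (M - B / t) - 1 / (2 * Real.log t) - c / Real.log t ^ 2)) t := by
  have h1 : HasDerivAt (fun u : ℝ => M - B / u) (B / t ^ 2) t := by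
    have := ((hasDerivAt_inv ht.ne').const_mul B).const_sub M
    simp only [← div_eq_mul_inv] at this
    convert! this using 1
    field_simp
  have h2 := (Real.hasDerivAt_log ht.ne')
  have h3 := (h1.log hP.ne').sub ((h2.log hl.ne').const_mul (1 / 2))
  have h4 := (h2.inv hl.ne').const_mul c
  have h5 := h3.add h4
  convert! h5 using 1
  have h6 : M * t - B ≠ 0 := by
    have e : M - B / t = (M * t - B) / t := by field_simp
    rw [e] at hP
    intro h; rw [h] at hP; simp at hP
  have h7 : M - B / t ≠ 0 := hP.ne'
  field_simp
  ring

/-- Between integers the derivative of `logMean f` at t is B(t)/t², so the sign of the derivative of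
`corrLogMean` is that of the difference of the two sides in the assumed inequality. -/
lemma corrLogMean_unit_interval (hlog : 20000 ≤ Real.log a) (ha : 1 ≤ a)
    (hM : ∀ u, a ≤ u → 0 < psum (f.pmul recip) u)
    (hf : ∀ u, a ≤ u → |2 * Real.log u * psum f u - u * psum (f.pmul recip) u| ≤
      345 / Real.log u * (u * psum (f.pmul recip) u))
    {c : ℝ} {k : ℕ} {u v : ℝ} (hu : a ≤ u) (hk : (k : ℝ) ≤ u)
    (huv : u ≤ v) (hv : v ≤ k + 1) :
    ((∀ t, a ≤ t → psum f t / t / logMean f t ≤ 1 / (2 * Real.log t) + c / Real.log t ^ 2) →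
      corrLogMean f c v ≤ corrLogMean f c u) ∧
    ((∀ t, a ≤ t → 1 / (2 * Real.log t) + c / Real.log t ^ 2 ≤ psum f t / t / logMean f t) →
      corrLogMean f c u ≤ corrLogMean f c v) := by
  set g : ℝ → ℝ := fun u => Real.log (psum (f.pmul recip) k - psum f k / u) -
    1 / 2 * Real.log (Real.log u) + c / Real.log u with hg
  have hgu : ∀ t, (k : ℝ) ≤ t → t ≤ k + 1 → corrLogMean f c t = g t := fun t h1 h2 => by
    rw [corrLogMean, logMean_eq f h1 h2]
  have hder : ∀ t ∈ Set.Icc u v, HasDerivAt g (1 / t * (psum f k / t / logMean f t -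
      1 / (2 * Real.log t) - c / Real.log t ^ 2)) t := by
    intro t ht
    have hat := hu.trans ht.1
    obtain ⟨h1, -, -, h2⟩ := psum_div_bounds hlog ha hM hf hat
    have h3 := logMean_eq f (hk.trans ht.1) (ht.2.trans hv)
    rw [h3] at h2 ⊢
    exact hasDerivAt_corrLogMean_aux (by linarith) (by linarith) h2
  have hcont : ContinuousOn g (Set.Icc u v) := fun t ht =>
    (hder t ht).continuousAt.continuousWithinAt
  have hdiff : DifferentiableOn ℝ g (interior (Set.Icc u v)) := fun t ht =>
    (hder t (interior_subset ht)).differentiableAt.differentiableWithinAt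
  have hpk : ∀ t ∈ interior (Set.Icc u v), psum f k = psum f t ∧ 0 < t := by
    intro t ht
    rw [interior_Icc] at ht
    have h0 : 0 < t := by linarith [ht.1]
    have : ⌊t⌋₊ = k := (Nat.floor_eq_iff h0.le).2 ⟨by linarith [ht.1], by linarith [ht.2]⟩
    exact ⟨by simp only [psum, this, Nat.floor_natCast], h0⟩
  rw [hgu u hk (huv.trans hv), hgu v (hk.trans huv) hv]
  constructor
  · intro h
    refine antitoneOn_of_deriv_nonpos (convex_Icc u v) hcont hdiff (fun t ht => ?_)
      (Set.left_mem_Icc.2 huv) (Set.right_mem_Icc.2 huv) huv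
    rw [(hder t (interior_subset ht)).deriv]
    obtain ⟨h1, h2⟩ := hpk t ht
    have := h t (hu.trans (interior_subset ht).1)
    rw [h1]
    exact mul_nonpos_of_nonneg_of_nonpos (by positivity) (by linarith)
  · intro h
    refine monotoneOn_of_deriv_nonneg (convex_Icc u v) hcont hdiff (fun t ht => ?_)
      (Set.left_mem_Icc.2 huv) (Set.right_mem_Icc.2 huv) huv
    rw [(hder t (interior_subset ht)).deriv]
    obtain ⟨h1, h2⟩ := hpk t ht
    have := h t (hu.trans (interior_subset ht).1)
    rw [h1]
    exact mul_nonneg (by positivity) (by linarith)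

lemma corrLogMean_antitone (hlog : 20000 ≤ Real.log a) (ha : 1 ≤ a)
    (hM : ∀ u, a ≤ u → 0 < psum (f.pmul recip) u)
    (hf : ∀ u, a ≤ u → |2 * Real.log u * psum f u - u * psum (f.pmul recip) u| ≤
      345 / Real.log u * (u * psum (f.pmul recip) u))
    {u v : ℝ} (hu : a ≤ u) (huv : u ≤ v) :
    corrLogMean f 175 v ≤ corrLogMean f 175 u := by
  refine le_of_le_on_unit_intervals (φ := corrLogMean f 175) (by linarith)
    (fun k u v hu hk huv hv => (corrLogMean_unit_interval hlog ha hM hf hu hk huv hv).1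
      fun t ht => ?_) hu huv
  obtain ⟨h1, h2, h3, h4⟩ := psum_div_bounds hlog ha hM hf ht
  have hMt := hM t ht
  rw [div_le_iff₀ h4]
  unfold logMean at *
  set l := Real.log t
  set M := psum (f.pmul recip) t
  set β := psum f t / t
  have hl0 : 0 < l := by linarith
  -- 350 = 2 · 175 exceeds 345 by 5, which pays for replacing M by the smaller mean M - B/t in the
  -- denominator.
  have e : 1 / (2 * l) + 175 / l ^ 2 = (l + 350) / (2 * l ^ 2) := by field_simp; ring
  rw [e, div_mul_eq_mul_div, le_div_iff₀ (by positivity)]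
  refine le_of_mul_le_mul_left ?_ (by positivity : 0 < 2 * l ^ 2)
  have h5 := mul_le_mul_of_nonneg_left h2 (by positivity : 0 ≤ 2 * l ^ 2 + (l + 350))
  have h6 : (l + 345) * (2 * l ^ 2 + (l + 350)) ≤ 2 * l ^ 2 * (l + 350) := by nlinarith
  have h7 := mul_le_mul_of_nonneg_right h6 hMt.le
  linarith

lemma corrLogMean_monotone (hlog : 20000 ≤ Real.log a) (ha : 1 ≤ a)
    (hM : ∀ u, a ≤ u → 0 < psum (f.pmul recip) u)
    (hf : ∀ u, a ≤ u → |2 * Real.log u * psum f u - u * psum (f.pmul recip) u| ≤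
      345 / Real.log u * (u * psum (f.pmul recip) u))
    {u v : ℝ} (hu : a ≤ u) (huv : u ≤ v) :
    corrLogMean f (-175) u ≤ corrLogMean f (-175) v := by
  refine neg_le_neg_iff.1 (le_of_le_on_unit_intervals (φ := fun t => -corrLogMean f (-175) t)
    (by linarith) (fun k u v hu hk huv hv => neg_le_neg
      ((corrLogMean_unit_interval hlog ha hM hf hu hk huv hv).2 fun t ht => ?_)) hu huv)
  obtain ⟨h1, h2, h3, h4⟩ := psum_div_bounds hlog ha hM hf ht
  have hMt := hM t ht
  rw [le_div_iff₀ h4]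
  unfold logMean at *
  set l := Real.log t
  set M := psum (f.pmul recip) t
  set β := psum f t / t
  have hl0 : 0 < l := by linarith
  have hβ : 0 ≤ β := by
    by_contra! h
    nlinarith [mul_pos (by linarith : 0 < l - 345) hMt, mul_pos hl0 hl0]
  have e : 1 / (2 * l) + -175 / l ^ 2 = (l - 350) / (2 * l ^ 2) := by field_simp; ring
  rw [e, div_mul_eq_mul_div, div_le_iff₀ (by positivity)]
  nlinarith [mul_nonneg (by linarith : 0 ≤ l - 350) hβ]
end

/-- If `B_f(x) ≤ B_g(x)` at one large `x`, then the logarithmic averages stay comparable beyond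
`x`. -/
theorem psum_recip_le_of_psum_le {f g : ArithmeticFunction ℝ} {x : ℝ} (hx1 : 1 ≤ x)
    (hx : 20970 ≤ Real.log x)
    (hMf : ∀ u, x ≤ u → 0 < psum (f.pmul recip) u) (hMg : ∀ u, x ≤ u → 0 < psum (g.pmul recip) u)
    (hf : ∀ u, x ≤ u → |2 * Real.log u * psum f u - u * psum (f.pmul recip) u| ≤
      345 / Real.log u * (u * psum (f.pmul recip) u))
    (hg : ∀ u, x ≤ u → |2 * Real.log u * psum g u - u * psum (g.pmul recip) u| ≤
      345 / Real.log u * (u * psum (g.pmul recip) u))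
    (h : psum f x ≤ psum g x) {u : ℝ} (hu : x ≤ u) :
    psum (f.pmul recip) u ≤ 1.06 * psum (g.pmul recip) u := by
  have hlog : 20000 ≤ Real.log x := by linarith
  have hu0 : 0 < u := by linarith
  obtain ⟨-, fx1, fx2, fx3⟩ := psum_div_bounds hlog hx1 hMf hf le_rfl
  obtain ⟨-, gx1, gx2, gx3⟩ := psum_div_bounds hlog hx1 hMg hg le_rfl
  obtain ⟨hlu, fu1, fu2, fu3⟩ := psum_div_bounds hlog hx1 hMf hf hu
  obtain ⟨-, gu1, gu2, gu3⟩ := psum_div_bounds hlog hx1 hMg hg hu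
  have hmono : ∀ {F : ArithmeticFunction ℝ} {t : ℝ}, 20000 ≤ Real.log t →
      0 < psum (F.pmul recip) t →
      (Real.log t - 345) * psum (F.pmul recip) t ≤ (psum F t / t) * (2 * Real.log t ^ 2) →
      (psum F t / t) * (2 * Real.log t ^ 2) ≤ (Real.log t + 345) * psum (F.pmul recip) t →
      logMean F t ≤ psum (F.pmul recip) t ∧ 0.9999 * psum (F.pmul recip) t ≤ logMean F t := by
    intro F t hl hM h1 h2
    unfold logMean
    set l := Real.log t
    set M := psum (F.pmul recip) t
    set β := psum F t / t
    have hl2 : 0 < 2 * l ^ 2 := by positivity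
    constructor
    · have : 0 ≤ β * (2 * l ^ 2) := (mul_nonneg (by linarith) hM.le).trans h1
      linarith [nonneg_of_mul_nonneg_left this hl2]
    · have h3 : (l + 345) * M ≤ (0.0001 * M) * (2 * l ^ 2) := by
        have : l + 345 ≤ 0.0001 * (2 * l ^ 2) := by nlinarith
        nlinarith
      linarith [le_of_mul_le_mul_right (h2.trans h3) hl2]
  obtain ⟨fx4, -⟩ := hmono hlog (hMf x le_rfl) fx2 fx1
  obtain ⟨-, gx5⟩ := hmono hlog (hMg x le_rfl) gx2 gx1
  obtain ⟨-, fu5⟩ := hmono hlu (hMf u hu) fu2 fu1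
  obtain ⟨gu4, -⟩ := hmono hlu (hMg u hu) gu2 gu1
  have hfx0 := hMf x le_rfl
  have hgx0 := hMg x le_rfl
  have hcmp : logMean f x ≤ 1.0337 * logMean g x := by
    have h1 : psum f x / x * (2 * Real.log x ^ 2) ≤ psum g x / x * (2 * Real.log x ^ 2) := by
      gcongr
    have h2 := (fx2.trans h1).trans gx1
    set l := Real.log x
    -- The ratio (l + 345)/(l - 345) is below 1.0335 once l ≥ 20970.
    have h3 : psum (f.pmul recip) x ≤ 1.0335 * psum (g.pmul recip) x := by
      refine le_of_mul_le_mul_left ?_ (by linarith : 0 < l - 345)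
      nlinarith
    linarith
  have hA := corrLogMean_antitone hlog hx1 hMf hf le_rfl hu
  have hB := corrLogMean_monotone hlog hx1 hMg hg le_rfl hu
  unfold corrLogMean at hA hB
  have hd : 0 ≤ 175 / Real.log u := by positivity
  have hd2 : 175 / Real.log x ≤ 0.00835 := by
    rw [div_le_iff₀ (by linarith)]; linarith
  have hC : Real.log (logMean f x) ≤ Real.log 1.0337 + Real.log (logMean g x) := by
    rw [← Real.log_mul (by norm_num) gx3.ne']
    exact Real.log_le_log fx3 hcmp
  rw [neg_div, neg_div] at hB
  -- The log log terms cancel between f and g; 0.0167 is twice the bound for the correction 175/log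
  -- x.
  have hD : Real.log (logMean f u) ≤ 0.0167 + Real.log 1.0337 + Real.log (logMean g u) := by
    linarith
  have hE : logMean f u ≤ Real.exp 0.0167 * 1.0337 * logMean g u := by
    rw [← Real.exp_log fu3]
    refine (Real.exp_le_exp.2 hD).trans_eq ?_
    rw [Real.exp_add, Real.exp_add, Real.exp_log (by norm_num), Real.exp_log gu3]
  have hexp : Real.exp 0.0167 ≤ 1.017 := by
    have := Real.exp_bound_div_one_sub_of_interval (x := 0.0167) (by norm_num) (by norm_num)
    norm_num at this ⊢
    linarith
  have hF : Real.exp 0.0167 * 1.0337 * logMean g u ≤ 1.017 * 1.0337 * logMean g u := by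
    gcongr
  linarith

/-! ### Convolution squares and the comparison at infinity -/

lemma sq_psum_le_psum_mul_self {a : ArithmeticFunction ℝ} (ha : ∀ n, 0 ≤ a n) {y : ℝ} (hy : 1 ≤ y) :
    psum a y ^ 2 ≤ psum (a * a) (y ^ 2) := by
  rw [psum_mul, sq]
  nth_rw 1 [psum]
  rw [sum_mul]
  have hyy : y ≤ y ^ 2 := by nlinarith
  refine (sum_le_sum fun n hn => ?_).trans
    (sum_le_sum_of_subset_of_nonneg (Ioc_subset_Ioc_right (Nat.floor_mono hyy)) fun n _ _ =>
      mul_nonneg (ha n) (psum_nonneg ha _))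
  refine mul_le_mul_of_nonneg_left (psum_mono_right ha ?_) (ha n)
  obtain ⟨h1, h2⟩ := one_le_div_of_mem hn
  rw [one_le_div h2] at h1
  rw [le_div_iff₀ h2]
  nlinarith

lemma psum_mul_le_of_le {a b c : ArithmeticFunction ℝ} (ha : ∀ n, 0 ≤ a n) {l D : ℝ}
    (h : ∀ u, psum b u ≤ l * psum c u + D) (y : ℝ) :
    psum (a * b) y ≤ l * psum (a * c) y + D * psum a y := by
  rw [psum_mul, psum_mul, psum, mul_sum, mul_sum, ← sum_add_distrib]
  refine sum_le_sum fun n _ => ?_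
  have := mul_le_mul_of_nonneg_left (h (y / n)) (ha n)
  linarith

/-- Domination of the summatory function of `a` by that of `c` transfers to the convolution
squares. -/
lemma psum_mul_self_le {a c : ArithmeticFunction ℝ} (ha : ∀ n, 0 ≤ a n) (hc : ∀ n, 0 ≤ c n)
    {l D : ℝ} (hl : 0 ≤ l) (h : ∀ u, psum a u ≤ l * psum c u + D) (y : ℝ) :
    psum (a * a) y ≤ l ^ 2 * psum (c * c) y + l * D * psum c y + D * psum a y := by
  have h1 := psum_mul_le_of_le ha h y
  have h2 := psum_mul_le_of_le hc h y
  rw [mul_comm a c] at h1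
  have := mul_le_mul_of_nonneg_left h2 hl
  nlinarith

/-- A function of size O(√(log y)) cannot dominate A log y. The term γ m is split as ε m² + γ²/(4ε),
with ε chosen so that ε m² uses only half of A log y. -/
lemma not_forall_log_mul_le {m : ℝ → ℝ} {A α β γ δ : ℝ} (hA : 0 < A) (hα : 0 < α)
    (h1 : ∀ y, 1 ≤ y → m y ^ 2 ≤ α * Real.log y + β) (Y : ℝ) :
    ¬ ∀ y, 1 ≤ y → Y ≤ y → A * Real.log y ≤ γ * m y + δ := by
  intro h2
  set ε := A / (2 * α) with hε
  have hε0 : 0 < ε := by positivity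
  set T := 2 / A * (ε * β + γ ^ 2 / (4 * ε) + δ) + 1 with hT
  set y := max (max 1 Y) (Real.exp T) with hy
  have hy1 : 1 ≤ y := (le_max_left 1 Y).trans (le_max_left _ _)
  have hyY : Y ≤ y := (le_max_right 1 Y).trans (le_max_left _ _)
  have hyT : T ≤ Real.log y := by
    rw [← Real.log_exp T]
    exact Real.log_le_log (Real.exp_pos T) (le_max_right _ _)
  have k1 := h1 y hy1
  have k2 := h2 y hy1 hyY
  have k3 : γ * m y ≤ ε * m y ^ 2 + γ ^ 2 / (4 * ε) := by
    have : 0 ≤ (2 * ε * m y - γ) ^ 2 / (4 * ε) := by positivity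
    have e : (2 * ε * m y - γ) ^ 2 / (4 * ε) = ε * m y ^ 2 + γ ^ 2 / (4 * ε) - γ * m y := by
      field_simp
      ring
    linarith
  have k4 := mul_le_mul_of_nonneg_left k1 hε0.le
  have k5 : ε * (α * Real.log y) = A / 2 * Real.log y := by rw [hε]; field_simp
  have k6 : A / 2 * T = ε * β + γ ^ 2 / (4 * ε) + δ + A / 2 := by rw [hT]; field_simp
  have k7 := mul_le_mul_of_nonneg_left hyT (by positivity : 0 ≤ A / 2)
  linarith

/-- The indicator function of a finite set of positive integers. -/
noncomputable def finsetInd (D : Finset ℕ) (h0 : 0 ∉ D) : ArithmeticFunction ℝ :=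
  ⟨fun n => if n ∈ D then 1 else 0, by simp [h0]⟩

lemma finsetInd_apply (D : Finset ℕ) (h0 : 0 ∉ D) (n : ℕ) :
    finsetInd D h0 n = if n ∈ D then 1 else 0 := rfl

open Classical in
/-- The indicator function of the positive integers of the form `c * b ^ 2`. -/
noncomputable def mulSqInd (c : ℕ) : ArithmeticFunction ℝ :=
  ⟨fun n => if n ≠ 0 ∧ ∃ b, n = c * b ^ 2 then 1 else 0, by simp⟩

open Classical in
lemma mulSqInd_apply (c n : ℕ) :
    mulSqInd c n = if n ≠ 0 ∧ ∃ b, n = c * b ^ 2 then 1 else 0 := rfl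

lemma mulSqInd_nonneg (c n : ℕ) : 0 ≤ mulSqInd c n := by
  rw [mulSqInd_apply]; split_ifs <;> norm_num

lemma psum_mulSqInd_recip_le {c : ℕ} (hc : 0 < c) (y : ℝ) :
    psum ((mulSqInd c).pmul recip) y ≤ Real.pi ^ 2 / 6 / c := by
  have hc0 : (0 : ℝ) < c := by exact_mod_cast hc
  have hinj : ∀ a ∈ Ioc 0 ⌊y⌋₊, ∀ b ∈ Ioc 0 ⌊y⌋₊, c * a ^ 2 = c * b ^ 2 → a = b := by
    intro a _ b _ h
    simpa using Nat.eq_of_mul_eq_mul_left hc h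
  calc psum ((mulSqInd c).pmul recip) y
      ≤ ∑ n ∈ ((Ioc 0 ⌊y⌋₊).image (fun b : ℕ => c * b ^ 2) : Finset ℕ), ((n : ℕ) : ℝ)⁻¹ := by
        rw [psum, ← sum_filter_ne_zero]
        refine (sum_le_sum (g := fun n : ℕ => (n : ℝ)⁻¹) fun n _ => ?_).trans
          (sum_le_sum_of_subset_of_nonneg (fun n hn => ?_) fun n _ _ => by positivity)
        · rw [pmul_apply, recip_apply, mulSqInd_apply]
          split_ifs <;> simp
        · obtain ⟨h1, h2⟩ := mem_filter.1 hn
          rw [pmul_apply, mulSqInd_apply] at h2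
          split_ifs at h2 with h3
          · obtain ⟨h4, b, rfl⟩ := h3
            refine mem_image.2 ⟨b, mem_Ioc.2 ⟨?_, ?_⟩, rfl⟩
            · rcases Nat.eq_zero_or_pos b with rfl | hb
              · simp at h4
              · exact hb
            · refine le_trans ?_ (mem_Ioc.1 h1).2
              nlinarith [Nat.zero_le b, Nat.le_self_pow two_ne_zero b]
          · simp at h2
    _ = ∑ b ∈ Ioc 0 ⌊y⌋₊, 1 / (b : ℝ) ^ 2 / c := by
        rw [sum_image hinj]
        refine sum_congr rfl fun b _ => ?_
        push_cast
        rw [mul_inv]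
        ring
    _ ≤ Real.pi ^ 2 / 6 / c := by
        rw [← sum_div]
        gcongr
        exact sum_le_hasSum _ (fun b _ => by positivity) hasSum_zeta_two

section
variable {χ : ArithmeticFunction ℝ} {p₀ : ℕ}

/-- The split and nonsplit parts of n are coprime and determined by n, so at most one term of the
convolution survives. -/
lemma splitInd_mul_finsetInd_le {D : Finset ℕ} (h0 : 0 ∉ D)
    (hD : ∀ d ∈ D, ∀ p, p.Prime → p ∣ d → χ p ≠ 1) (hD1 : ∀ d ∈ D, normInd χ d = 1) (n : ℕ) :
    (splitInd χ * finsetInd D h0) n ≤ normInd χ n := by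
  rw [mul_apply]
  by_cases h : ∀ p ∈ n.divisorsAntidiagonal, splitInd χ p.1 * finsetInd D h0 p.2 = 0
  · rw [sum_eq_zero h]; exact normInd_nonneg χ n
  push Not at h
  obtain ⟨p, hp, hne⟩ := h
  have hsupp : ∀ q : ℕ × ℕ, splitInd χ q.1 * finsetInd D h0 q.2 ≠ 0 →
      splitInd χ q.1 ≠ 0 ∧ q.2 ∈ D := by
    intro q hq
    refine ⟨left_ne_zero_of_mul hq, ?_⟩
    by_contra hq2
    exact right_ne_zero_of_mul hq (by rw [finsetInd_apply, if_neg hq2])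
  have hcop : ∀ e d, splitInd χ e ≠ 0 → d ∈ D → Nat.Coprime d e := by
    intro e d he hd
    refine Nat.Coprime.symm (Nat.coprime_of_dvd fun q hq hqe hqd => ?_)
    exact hD d hd q hq hqd ((splitInd_eq_one he).2.1 q hq hqe)
  obtain ⟨hp1, hp2⟩ := hsupp p hne
  have hpn := (Nat.mem_divisorsAntidiagonal.1 hp).1
  rw [sum_eq_single p]
  · rw [← hpn, normInd_split_mul hp1, hD1 _ hp2, (splitInd_eq_one hp1).2.2, one_mul,
      finsetInd_apply, if_pos hp2]
  · intro q hq hqp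
    by_contra hq0
    obtain ⟨hq1, hq2⟩ := hsupp q hq0
    have hqn := (Nat.mem_divisorsAntidiagonal.1 hq).1
    have hpq : p.1 * p.2 = q.1 * q.2 := hpn.trans hqn.symm
    have d1 : p.2 ∣ q.2 := (hcop q.1 p.2 hq1 hp2).dvd_of_dvd_mul_left (hpq ▸ dvd_mul_left _ _)
    have d2 : q.2 ∣ p.2 := (hcop p.1 q.2 hp1 hq2).dvd_of_dvd_mul_left (hpq ▸ dvd_mul_left _ _)
    have e2 : q.2 = p.2 := Nat.dvd_antisymm d2 d1
    have hpos : 0 < p.2 := Nat.pos_of_ne_zero fun h => h0 (h ▸ hp2)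
    rw [e2] at hpq
    exact hqp (Prod.ext (Nat.eq_of_mul_eq_mul_right hpos hpq).symm e2)
  · exact fun h => absurd hp h

lemma exists_split_mul (n : ℕ) : normInd χ n = 1 → ∃ e d, n = e * d ∧ splitInd χ e = 1 ∧
    normInd χ d = 1 ∧ ∀ p, p.Prime → p ∣ d → χ p ≠ 1 := by
  induction n using Nat.strong_induction_on with
  | _ n ih =>
    intro hn
    by_cases h : ∃ p, p.Prime ∧ p ∣ n ∧ χ p = 1
    · obtain ⟨p, hp, ⟨m, rfl⟩, hc⟩ := h
      have hsp : splitInd χ p = 1 := by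
        have := splitInd_prime_pow_pos χ hp one_ne_zero
        rwa [pow_one, if_pos hc] at this
      rw [normInd_split_mul (by rw [hsp]; exact one_ne_zero)] at hn
      have hm : 0 < m := Nat.pos_of_ne_zero (normInd_eq_one_iff.1 hn).1
      obtain ⟨e, d, h1, h2, h3, h4⟩ := ih m (by nlinarith [hp.two_le]) hn
      exact ⟨p * e, d, by rw [h1, mul_assoc], by rw [splitInd_mul, hsp, h2, one_mul], h3, h4⟩
    · push Not at h
      exact ⟨1, n, (one_mul n).symm, splitInd_one χ, hn, h⟩

/-- After the split primes are removed, the squarefree part of the cofactor has no inert prime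
factor, hence is 1 or p₀. -/
lemma normInd_le_splitInd_mul (hχ : IsQuadChar χ p₀) (n : ℕ) :
    normInd χ n ≤ (splitInd χ * (mulSqInd 1 + mulSqInd p₀)) n := by
  have hnn : ∀ k, 0 ≤ (mulSqInd 1 + mulSqInd p₀) k := fun k => by
    rw [ArithmeticFunction.add_apply]
    exact add_nonneg (mulSqInd_nonneg _ _) (mulSqInd_nonneg _ _)
  have hterm : ∀ p ∈ n.divisorsAntidiagonal,
      0 ≤ splitInd χ p.1 * (mulSqInd 1 + mulSqInd p₀) p.2 :=
    fun p _ => mul_nonneg (splitInd_nonneg χ _) (hnn _)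
  rw [mul_apply]
  by_cases hf : normInd χ n = 0
  · rw [hf]; exact sum_nonneg hterm
  replace hf := (normInd_eq_one hf).2.2
  have hn0 := (normInd_eq_one_iff.1 hf).1
  obtain ⟨e, d, h1, h2, h3, h4⟩ := exists_split_mul n hf
  have hd0 := (normInd_eq_one_iff.1 h3).1
  rw [hf]
  refine le_trans ?_ (single_le_sum hterm (Nat.mem_divisorsAntidiagonal.2 ⟨h1.symm, hn0⟩ :
    (e, d) ∈ n.divisorsAntidiagonal))
  rw [h2, one_mul, ArithmeticFunction.add_apply]
  obtain ⟨a, b, hab, ha⟩ := Nat.sq_mul_squarefree d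
  have hpa : ∀ p ∈ a.primeFactors, p = p₀ := by
    intro p hp
    have hpp := Nat.prime_of_mem_primeFactors hp
    have hpd := Nat.dvd_of_mem_primeFactors hp
    rcases hχ.vals p with h | h | h
    · exact hχ.ram p hpp h
    · exact absurd h (h4 p hpp (hab ▸ hpd.mul_left _))
    · exact absurd h (not_inert_of_squarefree ha (by rw [hab]; exact h3) hpp hpd)
  have hprod := Nat.prod_primeFactors_of_squarefree ha
  rcases subset_singleton_iff.1 (fun p hp => mem_singleton.2 (hpa p hp)) with h | h
  · have hd : d = 1 * b ^ 2 := by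
      rw [h, prod_empty] at hprod
      rw [← hab, ← hprod, mul_comm]
    have : mulSqInd 1 d = 1 := by rw [mulSqInd_apply, if_pos ⟨hd0, b, hd⟩]
    rw [this]; linarith [mulSqInd_nonneg p₀ d]
  · have hd : d = p₀ * b ^ 2 := by
      rw [h, prod_singleton] at hprod
      rw [← hab, ← hprod, mul_comm]
    have : mulSqInd p₀ d = 1 := by rw [mulSqInd_apply, if_pos ⟨hd0, b, hd⟩]
    rw [this]; linarith [mulSqInd_nonneg 1 d]

lemma mul_le_mul_conv {a b c : ArithmeticFunction ℝ} (hc : ∀ n, 0 ≤ c n) (h : ∀ n, a n ≤ b n)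
    (n : ℕ) : (a * c) n ≤ (b * c) n := by
  rw [mul_apply, mul_apply]
  exact sum_le_sum fun p _ => mul_le_mul_of_nonneg_right (h _) (hc _)

lemma exists_abs_psum_recip_sub_le (hχ : IsQuadChar χ p₀) :
    ∃ K, ∀ y, 1 ≤ y →
      |psum (((ζ : ArithmeticFunction ℝ) * χ).pmul recip) y - valL χ * Real.log y| ≤ K := by
  obtain ⟨C, -, hT⟩ := exists_psum_recip_approx
    (fun t ht => abs_psum_zeta_mul_sub_le hχ (y := t) ht)
  refine ⟨6 + |C|, fun y hy => ?_⟩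
  have h1 := hT y hy
  have h2 : 3 * 2 / √y ≤ 6 := by
    have := Real.one_le_sqrt.2 hy
    rw [div_le_iff₀ (by linarith)]; linarith
  have h3 := abs_add_le (psum (((ζ : ArithmeticFunction ℝ) * χ).pmul recip) y -
    valL χ * Real.log y - C) C
  rw [sub_add_cancel] at h3
  linarith

/-- A lower bound for the logarithmic average of the convolution square of `normInd χ`. -/
lemma exists_le_psum_mul_self (hχ : IsQuadChar χ p₀) {D : Finset ℕ} (h0 : 0 ∉ D)
    (hD : ∀ d ∈ D, ∀ p, p.Prime → p ∣ d → χ p ≠ 1) (hD1 : ∀ d ∈ D, normInd χ d = 1) :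
    ∃ K Y, ∀ y, 1 ≤ y → Y ≤ y → (valL χ * ∑ d ∈ D, (d : ℝ)⁻¹) * Real.log y - K ≤
      psum ((normInd χ).pmul recip * (normInd χ).pmul recip) y := by
  obtain ⟨K, hK⟩ := exists_abs_psum_recip_sub_le hχ
  refine ⟨∑ d ∈ D, (d : ℝ)⁻¹ * (valL χ * Real.log d + K), ((D.sup id : ℕ) : ℝ), fun y hy hY => ?_⟩
  have hdy : ∀ d ∈ D, (0 : ℝ) < d ∧ (d : ℝ) ≤ y := by
    intro d hd
    refine ⟨by exact_mod_cast Nat.pos_of_ne_zero fun h => h0 (h ▸ hd), le_trans ?_ hY⟩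
    exact_mod_cast le_sup (f := id) hd
  have h1 : psum ((finsetInd D h0).pmul recip * ((ζ : ArithmeticFunction ℝ) * χ).pmul recip) y ≤
      psum ((normInd χ).pmul recip * (normInd χ).pmul recip) y := by
    rw [← pmul_recip_mul, ← pmul_recip_mul, ← splitInd_mul_normInd hχ, ← mul_assoc,
      mul_comm (finsetInd D h0)]
    refine psum_mono (fun n => mul_le_mul_of_nonneg_right ?_ (by simp)) y
    exact mul_le_mul_conv (normInd_nonneg χ) (splitInd_mul_finsetInd_le h0 hD hD1) n
  refine le_trans ?_ h1
  have h2 : psum ((finsetInd D h0).pmul recip * ((ζ : ArithmeticFunction ℝ) * χ).pmul recip) y =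
      ∑ d ∈ D, (d : ℝ)⁻¹ * psum (((ζ : ArithmeticFunction ℝ) * χ).pmul recip) (y / d) := by
    rw [psum_mul]
    have hsub : D ⊆ Ioc 0 ⌊y⌋₊ := fun d hd =>
      mem_Ioc.2 ⟨by exact_mod_cast (hdy d hd).1, Nat.le_floor (hdy d hd).2⟩
    rw [← sum_subset hsub]
    · refine sum_congr rfl fun d hd => ?_
      rw [pmul_apply, finsetInd_apply, if_pos hd, one_mul, recip_apply]
    · intro d _ hd
      rw [pmul_apply, finsetInd_apply, if_neg hd, zero_mul, zero_mul]
  rw [h2, mul_sum, sum_mul, ← sum_sub_distrib]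
  refine sum_le_sum fun d hd => ?_
  obtain ⟨hd0, hdy⟩ := hdy d hd
  have h3 := (abs_le.1 (hK (y / d) ((one_le_div hd0).2 hdy))).1
  rw [Real.log_div (by linarith) hd0.ne'] at h3
  have h4 := mul_le_mul_of_nonneg_left (sub_le_iff_le_add.1 (neg_le_sub_iff_le_add.1 h3 |>
    fun h => sub_le_iff_le_add.2 h)) (inv_nonneg.2 hd0.le)
  linarith

/-- An upper bound for the logarithmic average of the convolution square of `normInd χ`. -/
lemma exists_psum_mul_self_le (hχ : IsQuadChar χ p₀) (hL : 0 ≤ valL χ) :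
    ∃ K, ∀ y, 1 ≤ y → psum ((normInd χ).pmul recip * (normInd χ).pmul recip) y ≤
      (Real.pi ^ 2 / 6 * (1 + 1 / p₀)) * (valL χ * Real.log y) + K := by
  obtain ⟨K, hK⟩ := exists_abs_psum_recip_sub_le hχ
  have hK0 : 0 ≤ K := (abs_nonneg _).trans (hK 1 le_rfl)
  refine ⟨(Real.pi ^ 2 / 6 * (1 + 1 / p₀)) * K, fun y hy => ?_⟩
  set g := mulSqInd 1 + mulSqInd p₀ with hg
  have hg0 : ∀ n, 0 ≤ g n := fun n => by
    rw [hg, ArithmeticFunction.add_apply]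
    exact add_nonneg (mulSqInd_nonneg _ _) (mulSqInd_nonneg _ _)
  have h1 : psum ((normInd χ).pmul recip * (normInd χ).pmul recip) y ≤
      psum (g.pmul recip * ((ζ : ArithmeticFunction ℝ) * χ).pmul recip) y := by
    rw [← pmul_recip_mul, ← pmul_recip_mul, ← splitInd_mul_normInd hχ, ← mul_assoc, mul_comm g]
    refine psum_mono (fun n => mul_le_mul_of_nonneg_right ?_ (by simp)) y
    exact mul_le_mul_conv (normInd_nonneg χ) (normInd_le_splitInd_mul hχ) n
  have h2 : psum (g.pmul recip) y ≤ Real.pi ^ 2 / 6 * (1 + 1 / p₀) := by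
    have e : g.pmul recip = (mulSqInd 1).pmul recip + (mulSqInd p₀).pmul recip := by
      ext n
      simp only [hg, pmul_apply, ArithmeticFunction.add_apply, add_mul]
    rw [e, psum_add]
    have k1 := psum_mulSqInd_recip_le one_pos y
    have k2 := psum_mulSqInd_recip_le hχ.prime.pos y
    rw [Nat.cast_one, div_one] at k1
    rw [mul_add, mul_one, mul_one_div]
    exact add_le_add k1 k2
  have hlog := Real.log_nonneg hy
  have h3 : psum (g.pmul recip * ((ζ : ArithmeticFunction ℝ) * χ).pmul recip) y ≤
      psum (g.pmul recip) y * (valL χ * Real.log y + K) := by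
    rw [psum_mul, psum, sum_mul]
    refine sum_le_sum fun n hn => mul_le_mul_of_nonneg_left ?_ (mul_nonneg (hg0 n) (by simp))
    obtain ⟨k1, k2⟩ := one_le_div_of_mem hn
    have k3 := (abs_le.1 (hK _ k1)).2
    have k4 : Real.log (y / n) ≤ Real.log y :=
      Real.log_le_log (by linarith) (div_le_self (by linarith)
        (by exact_mod_cast (mem_Ioc.1 hn).1))
    have k5 := mul_le_mul_of_nonneg_left k4 hL
    linarith
  have h4 : 0 ≤ valL χ * Real.log y + K := add_nonneg (mul_nonneg hL hlog) hK0
  have h5 := mul_le_mul_of_nonneg_right h2 h4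
  linarith
end

lemma IsQuadChar.approx {χ : ArithmeticFunction ℝ} {p₀ : ℕ} (hχ : IsQuadChar χ p₀) (hp : p₀ ≤ 3)
    (hL : 0.59 ≤ valL χ) (hL1 : valL χ ≤ 1) {x : ℝ} (hx1 : 1 ≤ x) (hx : 20970 ≤ Real.log x) :
    (∀ u, x ≤ u → 0 < psum ((normInd χ).pmul recip) u) ∧
    ∀ u, x ≤ u → |2 * Real.log u * psum (normInd χ) u - u * psum ((normInd χ).pmul recip) u| ≤
      345 / Real.log u * (u * psum ((normInd χ).pmul recip) u) := by
  have hlu : ∀ u, x ≤ u → 20000 ≤ Real.log u := fun u hu => by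
    have := Real.log_le_log (by linarith) hu
    linarith
  refine ⟨fun u hu => ?_, fun u hu => ?_⟩
  · have := psum_recip_ge hχ hL (hx1.trans hu) (hlu u hu)
    linarith
  · exact abs_two_log_mul_psum_sub_le_div_log hχ hp hL hL1 (hx1.trans hu) (hlu u hu)

/-- The comparison of two counting functions at a single large `x` from the comparison of the
constants. -/
theorem psum_normInd_lt {χ ψ : ArithmeticFunction ℝ} {p q : ℕ} (hχ : IsQuadChar χ p)
    (hψ : IsQuadChar ψ q) (hp : p ≤ 3) (hq : q ≤ 3) (hLχ : 0.59 ≤ valL χ) (hLχ1 : valL χ ≤ 1)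
    (hLψ : 0.59 ≤ valL ψ) (hLψ1 : valL ψ ≤ 1) {D : Finset ℕ} (h0 : 0 ∉ D)
    (hD : ∀ d ∈ D, ∀ p, p.Prime → p ∣ d → χ p ≠ 1) (hD1 : ∀ d ∈ D, normInd χ d = 1)
    (hconst : 1.06 ^ 2 * (Real.pi ^ 2 / 6 * (1 + 1 / q) * valL ψ) <
      valL χ * ∑ d ∈ D, (d : ℝ)⁻¹) {x : ℝ} (hx1 : 1 ≤ x) (hx : 20970 ≤ Real.log x) :
    psum (normInd ψ) x < psum (normInd χ) x := by
  by_contra! hle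
  obtain ⟨a1, a2⟩ := hχ.approx hp hLχ hLχ1 hx1 hx
  obtain ⟨b1, b2⟩ := hψ.approx hq hLψ hLψ1 hx1 hx
  have hcmp := fun u hu => psum_recip_le_of_psum_le hx1 hx a1 b1 a2 b2 hle (u := u) hu
  set F := (normInd χ).pmul recip with hF
  set G := (normInd ψ).pmul recip with hG
  have hF0 : ∀ n, 0 ≤ F n := fun n => mul_nonneg (normInd_nonneg χ n) (by simp)
  have hG0 : ∀ n, 0 ≤ G n := fun n => mul_nonneg (normInd_nonneg ψ n) (by simp)
  set d := psum F x with hd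
  have hd0 : 0 ≤ d := psum_nonneg hF0 x
  -- The constant d = M_χ(x) covers u ≤ x, which makes the domination uniform, as convolution
  -- requires.
  have hall : ∀ u, psum F u ≤ 1.06 * psum G u + d := by
    intro u
    have := psum_nonneg hG0 u
    rcases le_total x u with h | h
    · linarith [hcmp u h]
    · linarith [psum_mono_right hF0 h]
  obtain ⟨K₁, Y, hlow⟩ := exists_le_psum_mul_self hχ h0 hD hD1
  obtain ⟨K₂, hup⟩ := exists_psum_mul_self_le hψ (by linarith)
  set c := Real.pi ^ 2 / 6 * (1 + 1 / q) with hc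
  set A := valL χ * ∑ d ∈ D, (d : ℝ)⁻¹
  have hq0 : (0 : ℝ) < q := by exact_mod_cast hψ.prime.pos
  have hc0 : 0 < c := by positivity
  refine not_forall_log_mul_le (m := psum G) (A := A - 1.06 ^ 2 * (c * valL ψ))
    (α := 2 * (c * valL ψ)) (β := K₂) (γ := 2 * (1.06 * d)) (δ := 1.06 ^ 2 * K₂ + K₁ + d ^ 2)
    (by linarith) (by positivity) (fun y hy => ?_) Y (fun y hy hY => ?_)
  -- The square of the sum to y is bounded by the convolution sum to y², whence the factor 2 in α.
  · have h1 := sq_psum_le_psum_mul_self hG0 hy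
    have h2 := hup (y ^ 2) (by nlinarith)
    rw [Real.log_pow] at h2
    push_cast at h2
    linarith
  · have h1 := hlow y hy hY
    have h2 := psum_mul_self_le hF0 hG0 (by norm_num) hall y
    have h3 := hup y hy
    have h4 := mul_le_mul_of_nonneg_left (hall y) hd0
    linarith

/-! ### The characters modulo 4 and 3 -/

/-- The nonprincipal character modulo `4`. -/
noncomputable def chiFour : ArithmeticFunction ℝ :=
  ⟨fun n => if n % 4 = 1 then 1 else if n % 4 = 3 then -1 else 0, by simp⟩

/-- The nonprincipal character modulo `3`. -/
noncomputable def chiThree : ArithmeticFunction ℝ :=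
  ⟨fun n => if n % 3 = 1 then 1 else if n % 3 = 2 then -1 else 0, by simp⟩

lemma chiFour_apply (n : ℕ) :
    chiFour n = if n % 4 = 1 then 1 else if n % 4 = 3 then -1 else 0 := rfl

lemma chiThree_apply (n : ℕ) :
    chiThree n = if n % 3 = 1 then 1 else if n % 3 = 2 then -1 else 0 := rfl

lemma sum_chiFour (N : ℕ) :
    ∑ n ∈ Ioc 0 N, chiFour n = if N % 4 = 1 ∨ N % 4 = 2 then 1 else 0 := by
  induction N with
  | zero => simp
  | succ N ih =>
    rw [sum_Ioc_succ_top (Nat.zero_le N), ih, chiFour_apply]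
    have h : N % 4 = 0 ∨ N % 4 = 1 ∨ N % 4 = 2 ∨ N % 4 = 3 := by lia
    rcases h with h | h | h | h <;> simp [Nat.add_mod, h]

lemma sum_chiThree (N : ℕ) : ∑ n ∈ Ioc 0 N, chiThree n = if N % 3 = 1 then 1 else 0 := by
  induction N with
  | zero => simp
  | succ N ih =>
    rw [sum_Ioc_succ_top (Nat.zero_le N), ih, chiThree_apply]
    have h : N % 3 = 0 ∨ N % 3 = 1 ∨ N % 3 = 2 := by lia
    rcases h with h | h | h <;> simp [Nat.add_mod, h]

lemma isQuadChar_chiFour : IsQuadChar chiFour 2 where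
  one := by simp [chiFour_apply]
  mul m n := by
    simp only [chiFour_apply, Nat.mul_mod m n]
    have h1 : m % 4 = 0 ∨ m % 4 = 1 ∨ m % 4 = 2 ∨ m % 4 = 3 := by lia
    have h2 : n % 4 = 0 ∨ n % 4 = 1 ∨ n % 4 = 2 ∨ n % 4 = 3 := by lia
    rcases h1 with h1 | h1 | h1 | h1 <;> rcases h2 with h2 | h2 | h2 | h2 <;> simp [h1, h2]
  vals n := by rw [chiFour_apply]; split_ifs <;> simp
  ram p hp h := by
    rw [chiFour_apply] at h
    split_ifs at h with h1 h2
    · norm_num at h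
    · norm_num at h
    · exact ((Nat.prime_dvd_prime_iff_eq Nat.prime_two hp).1 (by lia)).symm
  prime := Nat.prime_two
  psum_nonneg N := by rw [sum_chiFour]; split_ifs <;> norm_num
  psum_le_one N := by rw [sum_chiFour]; split_ifs <;> norm_num

lemma isQuadChar_chiThree : IsQuadChar chiThree 3 where
  one := by simp [chiThree_apply]
  mul m n := by
    simp only [chiThree_apply, Nat.mul_mod m n]
    have h1 : m % 3 = 0 ∨ m % 3 = 1 ∨ m % 3 = 2 := by lia
    have h2 : n % 3 = 0 ∨ n % 3 = 1 ∨ n % 3 = 2 := by lia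
    rcases h1 with h1 | h1 | h1 <;> rcases h2 with h2 | h2 | h2 <;> simp [h1, h2]
  vals n := by rw [chiThree_apply]; split_ifs <;> simp
  ram p hp h := by
    rw [chiThree_apply] at h
    split_ifs at h with h1 h2
    · norm_num at h
    · norm_num at h
    · exact ((Nat.prime_dvd_prime_iff_eq Nat.prime_three hp).1 (by lia)).symm
  prime := Nat.prime_three
  psum_nonneg N := by rw [sum_chiThree]; split_ifs <;> norm_num
  psum_le_one N := by rw [sum_chiThree]; split_ifs <;> norm_num

lemma valL_chiFour_bounds : 0.77 ≤ valL chiFour ∧ valL chiFour ≤ 1 := by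
  constructor
  · refine le_trans ?_ (lowerL_le_valL isQuadChar_chiFour 40)
    rw [lowerL, sum_chiFour]
    norm_num [sum_Ioc_succ_top, chiFour_apply]
  · refine (valL_le_upperL isQuadChar_chiFour 1).trans ?_
    rw [lowerL, sum_chiFour]
    norm_num [chiFour_apply]

lemma valL_chiThree_bounds : 0.59 ≤ valL chiThree ∧ valL chiThree ≤ 0.63 := by
  have h : ∑ n ∈ Ioc 0 30, chiThree n / n ≤ 0.597 ∧ 0.59 ≤ ∑ n ∈ Ioc 0 30, chiThree n / n := by
    constructor <;> norm_num [sum_Ioc_succ_top, chiThree_apply]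
  constructor
  · refine le_trans ?_ (lowerL_le_valL isQuadChar_chiThree 30)
    rw [lowerL, sum_chiThree]
    norm_num at h ⊢
    linarith [h.2]
  · refine (valL_le_upperL isQuadChar_chiThree 30).trans ?_
    rw [lowerL, sum_chiThree]
    norm_num at h ⊢
    linarith [h.1]

lemma chiFour_eq_neg_one_iff (n : ℕ) : chiFour n = -1 ↔ n % 4 = 3 := by
  rw [chiFour_apply]; split_ifs with h1 h2 <;> norm_num <;> lia

lemma chiThree_eq_neg_one_iff (n : ℕ) : chiThree n = -1 ↔ n % 3 = 2 := by
  rw [chiThree_apply]; split_ifs with h1 h2 <;> norm_num <;> lia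

/-! ### Values of the two quadratic forms -/

lemma exists_int_iff_exists_nat_sq_add_sq (n : ℕ) :
    (∃ X Y : ℤ, (n : ℤ) = X ^ 2 + ((1 : ℕ) : ℤ) * Y ^ 2) ↔ ∃ x y : ℕ, n = x ^ 2 + y ^ 2 := by
  constructor
  · rintro ⟨X, Y, h⟩
    refine ⟨X.natAbs, Y.natAbs, ?_⟩
    zify
    rw [sq_abs, sq_abs, h]; push_cast; ring
  · rintro ⟨x, y, h⟩
    exact ⟨x, y, by rw [h]; push_cast; ring⟩

lemma cast_b_one {n : ℕ} (hn : n ≠ 0) : (b 1 n : ℝ) = normInd chiFour n := by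
  have h : (∃ X Y : ℤ, (n : ℤ) = X ^ 2 + ((1 : ℕ) : ℤ) * Y ^ 2) ↔
      (n ≠ 0 ∧ ∀ p, p.Prime → chiFour p = -1 → Even (n.factorization p)) := by
    rw [exists_int_iff_exists_nat_sq_add_sq, Nat.eq_sq_add_sq_iff, and_iff_right hn]
    simp only [chiFour_eq_neg_one_iff]
    constructor
    · intro h p hp hp4
      by_cases hpn : p ∣ n
      · rw [Nat.factorization_def n hp]
        exact h p (Nat.mem_primeFactors.2 ⟨hp, hpn, hn⟩) hp4
      · rw [Nat.factorization_eq_zero_of_not_dvd hpn]; exact Even.zero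
    · intro h p hp hp4
      have hpp := Nat.prime_of_mem_primeFactors hp
      rw [← Nat.factorization_def n hpp]
      exact h p hpp hp4
  unfold b
  rw [normInd_apply]
  by_cases hc : n ≠ 0 ∧ ∀ p, p.Prime → chiFour p = -1 → Even (n.factorization p)
  · rw [if_pos (h.2 hc), if_pos hc, Nat.cast_one]
  · rw [if_neg (fun hc' => hc (h.1 hc')), if_neg hc, Nat.cast_zero]

/-- Cubing is injective on units mod q when q ≡ 2 mod 3. As (x - y)³ - (2y)³ = (x - 3y)(x² + 3y²), a
zero with y ≠ 0 would give x = 3y and then 12y² = 0. -/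
lemma dvd_of_dvd_sq_add_three_mul_sq {q : ℕ} (hq : q.Prime) (hq2 : q ≠ 2) (hq3 : q % 3 = 2)
    {X Y : ℤ} (h : (q : ℤ) ∣ X ^ 2 + 3 * Y ^ 2) : (q : ℤ) ∣ X ∧ (q : ℤ) ∣ Y := by
  have : Fact q.Prime := ⟨hq⟩
  have hne : ∀ m : ℕ, ¬ q ∣ m → (m : ZMod q) ≠ 0 := fun m hm h0 =>
    hm ((ZMod.natCast_eq_zero_iff m q).1 h0)
  have h2 : (2 : ZMod q) ≠ 0 := by
    have := hne 2 fun h => hq2 ((Nat.prime_dvd_prime_iff_eq hq Nat.prime_two).1 h)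
    exact_mod_cast this
  have h3 : (3 : ZMod q) ≠ 0 := by
    have := hne 3 fun h => by
      rw [(Nat.prime_dvd_prime_iff_eq hq Nat.prime_three).1 h] at hq3
      norm_num at hq3
    exact_mod_cast this
  rw [← ZMod.intCast_zmod_eq_zero_iff_dvd] at h
  rw [← ZMod.intCast_zmod_eq_zero_iff_dvd, ← ZMod.intCast_zmod_eq_zero_iff_dvd]
  push_cast at h
  set x := (X : ZMod q)
  set y := (Y : ZMod q)
  have hy : y = 0 := by
    by_contra hy
    obtain ⟨k, hk⟩ : ∃ k, q - 1 = 3 * k + 1 := ⟨(q - 1) / 3, by lia⟩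
    have hv : x - y ≠ 0 := by
      intro hv
      have hxy : x = y := sub_eq_zero.1 hv
      have : 2 * 2 * (y * y) = 0 := by rw [hxy] at h; linear_combination h
      simp [h2, hy] at this
    have hcube : (x - y) ^ 3 = (2 * y) ^ 3 := by linear_combination (x - 3 * y) * h
    have e1 := ZMod.pow_card_sub_one_eq_one hv
    have e2 := ZMod.pow_card_sub_one_eq_one (mul_ne_zero h2 hy)
    rw [hk, pow_succ, pow_mul, hcube] at e1
    rw [hk, pow_succ, pow_mul] at e2
    have hpow : ((2 * y) ^ 3) ^ k ≠ 0 := pow_ne_zero _ (pow_ne_zero _ (mul_ne_zero h2 hy))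
    have e3 : x - y = 2 * y := mul_left_cancel₀ hpow (e1.trans e2.symm)
    have : 2 * 2 * 3 * (y * y) = 0 := by
      have hx : x = 3 * y := by linear_combination e3
      rw [hx] at h
      linear_combination h
    simp [h2, h3, hy] at this
  refine ⟨?_, hy⟩
  rw [hy] at h
  simpa using h

lemma even_factorization_of_eq_sq_add_three_mul_sq {q : ℕ} (hq : q.Prime) (hq3 : q % 3 = 2)
    (n : ℕ) : n ≠ 0 → (∃ X Y : ℤ, (n : ℤ) = X ^ 2 + 3 * Y ^ 2) → Even (n.factorization q) := by
  induction n using Nat.strong_induction_on with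
  | _ n ih =>
    rintro hn ⟨X, Y, h⟩
    by_cases hqn : q ∣ n
    swap
    · rw [Nat.factorization_eq_zero_of_not_dvd hqn]; exact Even.zero
    have hqn' : (q : ℤ) ∣ X ^ 2 + 3 * Y ^ 2 := by rw [← h]; exact_mod_cast hqn
    have descent : (q : ℤ) ∣ X → (q : ℤ) ∣ Y → Even (n.factorization q) := by
      rintro ⟨x, rfl⟩ ⟨y, rfl⟩
      have hn2 : (n : ℤ) = (q : ℤ) ^ 2 * (x ^ 2 + 3 * y ^ 2) := by rw [h]; ring
      obtain ⟨m, hm⟩ : q ^ 2 ∣ n := by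
        have : ((q ^ 2 : ℕ) : ℤ) ∣ n := ⟨_, by rw [hn2]; push_cast; rfl⟩
        exact_mod_cast this
      have hm0 : m ≠ 0 := by rintro rfl; exact hn (by simpa using hm)
      have hq0 : (q : ℤ) ≠ 0 := by exact_mod_cast hq.ne_zero
      have hm2 : (m : ℤ) = x ^ 2 + 3 * y ^ 2 := by
        have : (q : ℤ) ^ 2 * m = (q : ℤ) ^ 2 * (x ^ 2 + 3 * y ^ 2) := by
          rw [← hn2, hm]; push_cast; ring
        exact mul_left_cancel₀ (pow_ne_zero 2 hq0) this
      have hlt : m < n := by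
        rw [hm]
        have := Nat.pow_le_pow_left hq.two_le 2
        have : 0 < m := Nat.pos_of_ne_zero hm0
        nlinarith
      have := ih m hlt hm0 ⟨x, y, hm2⟩
      rw [hm, Nat.factorization_mul (pow_ne_zero 2 hq.ne_zero) hm0, Finsupp.add_apply,
        Nat.factorization_pow]
      simp [Nat.even_add, this]
    -- The prime 2 is exceptional: it divides X² + 3Y² when X and Y are both odd, but then n ≡ 4 mod
    -- 8 and the exponent is exactly 2.
    rcases eq_or_ne q 2 with rfl | hq2
    · by_cases hX : (2 : ℤ) ∣ X
      · refine descent hX ?_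
        have h1 : (2 : ℤ) ∣ 3 * Y ^ 2 := (dvd_add_right (hX.trans (dvd_pow_self X two_ne_zero))).1
          hqn'
        have h2 : (2 : ℤ) ∣ Y ^ 2 := by lia
        exact Int.prime_two.dvd_of_dvd_pow h2
      · have hX1 : X % 2 = 1 := by lia
        have hX8 := Int.eight_dvd_sq_sub_one_of_odd (Int.odd_iff.2 hX1)
        have hY1 : Y % 2 = 1 := by
          by_contra hY
          have : (2 : ℤ) ∣ Y := by lia
          have h1 : (2 : ℤ) ∣ Y ^ 2 := this.trans (dvd_pow_self Y two_ne_zero)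
          lia
        have hY8 := Int.eight_dvd_sq_sub_one_of_odd (Int.odd_iff.2 hY1)
        have hn8 : n % 8 = 4 := by lia
        obtain ⟨m, hm⟩ : 2 ^ 2 ∣ n := by lia
        have hm1 : ¬ 2 ∣ m := by lia
        have hm0 : m ≠ 0 := by rintro rfl; simp at hm1
        rw [hm, Nat.factorization_mul (by norm_num) hm0, Finsupp.add_apply,
          Nat.factorization_eq_zero_of_not_dvd hm1, Nat.factorization_pow]
        simp
    · obtain ⟨h1, h2⟩ := dvd_of_dvd_sq_add_three_mul_sq hq hq2 hq3 hqn'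
      exact descent h1 h2

lemma cast_b_three_le {n : ℕ} (hn : n ≠ 0) : (b 3 n : ℝ) ≤ normInd chiThree n := by
  unfold b
  split_ifs with h
  · have : normInd chiThree n = 1 := by
      rw [normInd_eq_one_iff]
      refine ⟨hn, fun p hp hc => ?_⟩
      exact even_factorization_of_eq_sq_add_three_mul_sq hp ((chiThree_eq_neg_one_iff p).1 hc) n hn
        (by simpa using h)
    rw [this]; simp
  · simpa using normInd_nonneg _ n

lemma cast_B_one (x : ℝ) : (B 1 x : ℝ) = psum (normInd chiFour) x := by
  unfold B psum
  push_cast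
  refine sum_congr rfl fun n hn => cast_b_one ?_
  exact Nat.one_le_iff_ne_zero.1 (mem_Icc.1 hn).1

lemma cast_B_three_le (x : ℝ) : (B 3 x : ℝ) ≤ psum (normInd chiThree) x := by
  unfold B psum
  push_cast
  refine sum_le_sum (s := Icc 1 ⌊x⌋₊) fun n hn => cast_b_three_le ?_
  exact Nat.one_le_iff_ne_zero.1 (mem_Icc.1 hn).1

/-! ### Numerical constants and conclusion -/

lemma log_ge_of_ten_pow_le {x : ℝ} (hx : (10 : ℝ) ^ (9111 : ℕ) ≤ x) : 20970 ≤ Real.log x := by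
  have h1 : (93 : ℝ) * Real.log 2 ≤ 28 * Real.log 10 := by
    have := Real.log_le_log (by norm_num) (by norm_num : (2 : ℝ) ^ 93 ≤ 10 ^ 28)
    rw [Real.log_pow, Real.log_pow] at this
    exact_mod_cast this
  have h2 := Real.log_two_gt_d9
  have h3 := Real.log_le_log (by positivity) hx
  rw [Real.log_pow] at h3
  push_cast at h3
  linarith

lemma normInd_chiFour_eq_one {d : ℕ} (hd : d ∈ ({1, 2, 4, 8, 9, 18} : Finset ℕ)) :
    normInd chiFour d = 1 := by
  have h2 : normInd chiFour 2 = 1 := by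
    have := normInd_prime_pow chiFour (k := 1) Nat.prime_two
    rw [pow_one] at this
    rw [this, if_neg]
    rw [chiFour_eq_neg_one_iff]
    norm_num
  have hsq : ∀ m : ℕ, m ≠ 0 → normInd chiFour (m ^ 2) = 1 := fun m hm => by
    have := normInd_sq_mul (χ := chiFour) (n := 1) hm
    rwa [mul_one, normInd_one] at this
  have hsq2 : ∀ m : ℕ, m ≠ 0 → normInd chiFour (m ^ 2 * 2) = 1 := fun m hm => by
    rw [normInd_sq_mul hm, h2]
  simp only [mem_insert, mem_singleton] at hd
  rcases hd with rfl | rfl | rfl | rfl | rfl | rfl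
  · exact normInd_one _
  · exact h2
  · exact hsq 2 (by norm_num)
  · exact hsq2 2 (by norm_num)
  · exact hsq 3 (by norm_num)
  · exact hsq2 3 (by norm_num)

theorem corollary1 (x : ℝ) (hx : (10 : ℝ) ^ (9111 : ℕ) ≤ x) : B 3 x ≤ B 1 x := by
  have hx1 : 1 ≤ x := (one_le_pow₀ (by norm_num)).trans hx
  obtain ⟨hF, hF1⟩ := valL_chiFour_bounds
  obtain ⟨hT, hT1⟩ := valL_chiThree_bounds
  have hmain : psum (normInd chiThree) x < psum (normInd chiFour) x := by
    -- The set D is a finite piece of the numbers 2^i b² free of primes ≡ 1 mod 4, large enough for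
    -- the strict inequality between constants: 0.77 · 49/24 ≈ 1.572 against 1.06² · (π²/6) · (4/3)
    -- · 0.63 ≈ 1.553.
    refine psum_normInd_lt isQuadChar_chiFour isQuadChar_chiThree (by norm_num) le_rfl
      (by linarith) hF1 hT (by linarith) (D := {1, 2, 4, 8, 9, 18}) (by simp)
      (fun d hd p hp hpd => ?_) (fun d hd => normInd_chiFour_eq_one hd) ?_ hx1
      (log_ge_of_ten_pow_le hx)
    · have h72 : p ∣ 2 ^ 3 * 3 ^ 2 := by
        refine hpd.trans ?_
        simp only [mem_insert, mem_singleton] at hd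
        rcases hd with rfl | rfl | rfl | rfl | rfl | rfl <;> decide
      have hp23 : p = 2 ∨ p = 3 := (hp.dvd_mul.1 h72).imp
        (fun h => (Nat.prime_dvd_prime_iff_eq hp Nat.prime_two).1 (hp.dvd_of_dvd_pow h))
        (fun h => (Nat.prime_dvd_prime_iff_eq hp Nat.prime_three).1 (hp.dvd_of_dvd_pow h))
      rcases hp23 with rfl | rfl <;> norm_num [chiFour_apply]
    · have hsum : ∑ d ∈ ({1, 2, 4, 8, 9, 18} : Finset ℕ), (d : ℝ)⁻¹ = 49 / 24 := by norm_num
      have hpi : Real.pi ^ 2 ≤ 9.8697 := by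
        nlinarith [Real.pi_lt_d4, Real.pi_pos]
      rw [hsum]
      push_cast
      have : Real.pi ^ 2 * valL chiThree ≤ 9.8697 * 0.63 :=
        mul_le_mul hpi hT1 (by linarith) (by norm_num)
      nlinarith
  have : (B 3 x : ℝ) ≤ B 1 x := by
    rw [cast_B_one]
    exact (cast_B_three_le x).trans hmain.le
  exact_mod_cast this
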